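/- Let $p$ be a prime and let $n\ge 1$ be an integer. Let $G$ be a generalized Poincaré duality pro-$p$ group of dimension $n$, i.e. an infinite pro-$p$ group such that, writing $H^i(G,\mathbb F_p)$ for the continuous cohomology groups with coefficients in the trivial discrete $G$-module $\mathbb F_p$, (a) $H^n(G,\mathbb F_p)\cong\mathbb F_p$, and (b) for every $0\le i\le n$ the cup product $H^i(G,\mathbb F_p)\times H^{n-i}(G,\mathbb F_p)\to H^n(G,\mathbb F_p)$ is a nondegenerate pairing: no nonzero element of either factor pairs to zero with all elements of the other factor. Then the cohomological dimension of $G$ is exactly $n$: $\operatorname{cd}(G)=n$, where $\operatorname{cd}(G)$ is the least $d\in\{0,1,2,\dots\}\cup\{\infty\}$ such that $H^i(G,A)=0$ for every $i>d$ and every discrete torsion $G$-module $A$. -/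

import Mathlib

open CategoryTheory

universe u v

section TopModuleHomology

variable {R : Type*} [Ring R] [TopologicalSpace R]

/-- The kernel-cokernel description of the homology of a short complex of topological modules. -/
noncomputable def topHomologyData (S : ShortComplex (TopModuleCat.{v} R)) : S.LeftHomologyData :=
  ⟨_, _, _, _, _, TopModuleCat.isLimitKer _, by simp, TopModuleCat.isColimitCoker _⟩

lemma iCycles_injective (S : ShortComplex (TopModuleCat.{v} R)) :
    Function.Injective S.iCycles.hom := by
  intro x y h
  rw [← (topHomologyData S).cyclesIso_hom_comp_i] at h
  have h2 : (topHomologyData S).cyclesIso.hom.hom x = (topHomologyData S).cyclesIso.hom.hom y :=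
    Subtype.val_injective h
  have e : ∀ w, (topHomologyData S).cyclesIso.inv.hom ((topHomologyData S).cyclesIso.hom.hom w)
      = w := fun w => ConcreteCategory.congr_hom (topHomologyData S).cyclesIso.hom_inv_id w
  rw [← e x, ← e y, h2]

lemma homologyπ_surjective (S : ShortComplex (TopModuleCat.{v} R)) :
    Function.Surjective S.homologyπ.hom := by
  intro x
  obtain ⟨y, hy⟩ := TopModuleCat.cokerπ_surjective _ ((topHomologyData S).homologyIso.hom.hom x)
  refine ⟨(topHomologyData S).cyclesIso.inv.hom y, ?_⟩
  have e : ∀ w, (topHomologyData S).homologyIso.inv.hom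
      ((topHomologyData S).homologyIso.hom.hom w) = w :=
    fun w => ConcreteCategory.congr_hom (topHomologyData S).homologyIso.hom_inv_id w
  have h := ConcreteCategory.congr_hom (topHomologyData S).π_comp_homologyIso_inv y
  rw [← e x, ← hy]
  exact h.symm

lemma homologyπ_eq_zero_iff (S : ShortComplex (TopModuleCat.{v} R)) (x : S.cycles) :
    S.homologyπ.hom x = 0 ↔ ∃ y, S.f.hom y = S.iCycles.hom x := by
  constructor
  · intro h
    have h1 := ConcreteCategory.congr_hom
      (ShortComplex.LeftHomologyData.homologyπ_comp_homologyIso_hom S (topHomologyData S)) x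
    have h2 : (topHomologyData S).π.hom ((topHomologyData S).cyclesIso.hom.hom x) = 0 := by
      refine h1.symm.trans ?_
      change (topHomologyData S).homologyIso.hom.hom (S.homologyπ.hom x) = 0
      rw [h, map_zero]
    obtain ⟨y, hy⟩ := (Submodule.Quotient.mk_eq_zero _).mp h2
    refine ⟨y, ?_⟩
    rw [← (topHomologyData S).cyclesIso_hom_comp_i, ← (topHomologyData S).f'_i]
    exact congrArg (topHomologyData S).i.hom hy
  · rintro ⟨y, hy⟩
    have h : S.toCycles.hom y = x := by
      apply iCycles_injective S
      rw [← hy]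
      exact ConcreteCategory.congr_hom S.toCycles_i y
    rw [← h]
    exact ConcreteCategory.congr_hom S.toCycles_comp_homologyπ y

variable (K : CochainComplex (TopModuleCat.{v} R) ℕ) (n : ℕ)

/-- The inclusion of the kernel of `d : K n → K (n + 1)` in `K n`, as a map to the cycles. -/
noncomputable def kerToCycles : TopModuleCat.ker (K.d n (n + 1)) ⟶ K.cycles n :=
  K.liftCycles (TopModuleCat.kerι (K.d n (n + 1))) (n + 1) (by simp) (TopModuleCat.kerι_comp _)

/-- The map sending an element of the kernel of `d : K n → K (n + 1)` to its class in the `n`-th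
cohomology of `K`. -/
noncomputable def kerToHomology : (K.d n (n + 1)).hom.ker →ₗ[R] K.homology n :=
  (kerToCycles K n ≫ K.homologyπ n).hom.toLinearMap

lemma iCycles_kerToCycles (z : (K.d n (n + 1)).hom.ker) :
    (K.iCycles n).hom ((kerToCycles K n).hom z) = z.1 :=
  ConcreteCategory.congr_hom (K.liftCycles_i (TopModuleCat.kerι (K.d n (n + 1))) (n + 1) (by simp)
    (TopModuleCat.kerι_comp _)) z

lemma kerToHomology_surjective : Function.Surjective (kerToHomology K n) := by
  intro x
  obtain ⟨c, rfl⟩ := homologyπ_surjective (K.sc n) x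
  have hc : (K.d n (n + 1)).hom ((K.iCycles n).hom c) = 0 :=
    ConcreteCategory.congr_hom (K.iCycles_d n (n + 1)) c
  refine ⟨⟨_, hc⟩, ?_⟩
  exact congrArg (K.homologyπ n).hom
    (iCycles_injective (K.sc n) (iCycles_kerToCycles K n ⟨_, hc⟩))

lemma kerToHomology_eq_zero_iff (z : (K.d n (n + 1)).hom.ker) :
    kerToHomology K n z = 0 ↔ ∃ (i : ℕ) (y : K.X i), (K.d i n).hom y = z.1 := by
  refine (homologyπ_eq_zero_iff (K.sc n) ((kerToCycles K n).hom z)).trans ?_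
  constructor
  · rintro ⟨y, hy⟩
    exact ⟨_, y, hy.trans (iCycles_kerToCycles K n z)⟩
  · rintro ⟨i, y, hy⟩
    by_cases h : (ComplexShape.up ℕ).Rel i n
    · obtain rfl := (ComplexShape.up ℕ).prev_eq' h
      exact ⟨y, hy.trans (iCycles_kerToCycles K n z).symm⟩
    · refine ⟨0, (map_zero _).trans ?_⟩
      rw [K.shape i n h] at hy
      exact hy.trans (iCycles_kerToCycles K n z).symm

end TopModuleHomology

section CupProduct

variable {k : Type v} [CommRing k] [TopologicalSpace k]
variable {G : Type u} [Group G] [TopologicalSpace G] [IsTopologicalGroup G]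

/-- A continuous `k`-bilinear `G`-equivariant pairing `A × B → C` of `G`-modules. -/
structure GPairing (A B C : TopRep.{u} k G) where
  toLin : A →ₗ[k] B →ₗ[k] C
  continuous_toLin : Continuous fun x : A × B => toLin x.1 x.2
  equivariant : ∀ (g : G) (a : A) (b : B), toLin (A.ρ g a) (B.ρ g b) = C.ρ g (toLin a b)

namespace GPairing

variable {A B C : TopRep.{u} k G}

/-- The restriction of a pairing to the invariants. -/
def invariants (φ : GPairing A B C) :
    A.ρ.invariants →ₗ[k] B.ρ.invariants →ₗ[k] C.ρ.invariants :=
  LinearMap.mk₂ k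
    (fun a b => ⟨φ.toLin a.1 b.1, fun g => by rw [← φ.equivariant, a.2 g, b.2 g]⟩)
    (by intros; ext1; simp) (by intros; ext1; simp) (by intros; ext1; simp)
    (by intros; ext1; simp)

/-- The pointwise pairing `C(G, A) × C(G, B) → C(G, C)`, `(f, g) ↦ (x ↦ ⟨f x, g x⟩)`. -/
def diag (φ : GPairing A B C) : GPairing A.coind₁ B.coind₁ C.coind₁ where
  toLin := LinearMap.mk₂ k
    (fun (f : C(G, A)) (g : C(G, B)) =>
      (⟨fun x : A × B => φ.toLin x.1 x.2, φ.continuous_toLin⟩ : C(A × B, C)).comp (f.prodMk g))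
    (by intros; ext; simp) (by intros; ext; simp) (by intros; ext; simp) (by intros; ext; simp)
  continuous_toLin := by
    have h : Continuous fun x : C(G, A) × C(G, B) => x.1.prodMk x.2 := by
      have e : (fun x : C(G, A) × C(G, B) => x.1.prodMk x.2) = fun x =>
          (⟨fun a : A => (a, (0 : B)), by fun_prop⟩ : C(A, A × B)).comp x.1 +
            (⟨fun b : B => ((0 : A), b), by fun_prop⟩ : C(B, A × B)).comp x.2 := by
        funext x
        ext y <;> simp
      rw [e]
      exact ((ContinuousMap.continuous_postcomp _).comp continuous_fst).add
        ((ContinuousMap.continuous_postcomp _).comp continuous_snd)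
    exact (ContinuousMap.continuous_postcomp _).comp h
  equivariant g a b := by
    ext x
    exact φ.equivariant g _ _

/-- The pairing `A × C(G, B) → C(G, C)`, `(a, g) ↦ (x ↦ ⟨a, g x⟩)`. -/
def right (φ : GPairing A B C) : GPairing A B.coind₁ C.coind₁ where
  toLin := φ.diag.toLin ∘ₗ (A.ρ.coind₁ι.toContinuousLinearMap : A →ₗ[k] A.coind₁)
  continuous_toLin := φ.diag.continuous_toLin.comp
    ((A.ρ.coind₁ι.toContinuousLinearMap.continuous.comp continuous_fst).prodMk continuous_snd)
  equivariant g a b := by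
    ext x
    exact φ.equivariant g _ _

/-- The pairing `C(G, A) × B → C(G, C)`, `(f, b) ↦ (x ↦ ⟨f x, b⟩)`. -/
def left (φ : GPairing A B C) : GPairing A.coind₁ B C.coind₁ where
  toLin := φ.diag.toLin.compl₂ (B.ρ.coind₁ι.toContinuousLinearMap : B →ₗ[k] B.coind₁)
  continuous_toLin := φ.diag.continuous_toLin.comp
    (continuous_fst.prodMk (B.ρ.coind₁ι.toContinuousLinearMap.continuous.comp continuous_snd))
  equivariant g a b := by
    ext x
    exact φ.equivariant g _ _

@[simp] lemma diag_apply (φ : GPairing A B C) (f : C(G, A)) (g : C(G, B)) (x : G) :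
    (φ.diag.toLin f g : C(G, C)) x = φ.toLin (f x) (g x) := rfl

@[simp] lemma right_apply (φ : GPairing A B C) (a : A) (g : C(G, B)) (x : G) :
    (φ.right.toLin a g : C(G, C)) x = φ.toLin a (g x) := rfl

@[simp] lemma left_apply (φ : GPairing A B C) (f : C(G, A)) (b : B) (x : G) :
    (φ.left.toLin f b : C(G, C)) x = φ.toLin (f x) b := rfl

/-- The pairing `(a, g) ↦ ((x₁, …, x_q) ↦ ⟨a, g (x₁, …, x_q)⟩)` of `A` with functions of `q = r`
variables. -/
def rightIter (φ : GPairing A B C) :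
    (q r : ℕ) → q = r → GPairing A (TopRep.resolutionX.{v, u, u} B q) (TopRep.resolutionX.{v, u, u} C r)
  | 0, 0, _ => φ
  | 0, _ + 1, h => absurd h (by omega)
  | _ + 1, 0, h => absurd h (by omega)
  | q + 1, r + 1, h => (rightIter φ q r (by omega)).right

/-- The cup product of a homogeneous `p`-cochain and a homogeneous `q`-cochain, `p + q = r`. In
terms of functions of several variables,
`(f ∪ g) (x₀, …, x_r) = ⟨f (x₀, …, x_p), g (x_p, …, x_r)⟩`. -/
def cochain (φ : GPairing A B C) :
    (p q r : ℕ) → p + q = r → GPairing (TopRep.resolutionX.{v, u, u} A (p + 1))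
      (TopRep.resolutionX.{v, u, u} B (q + 1)) (TopRep.resolutionX.{v, u, u} C (r + 1))
  | 0, q, r, h => (φ.rightIter q r (by omega)).diag
  | _ + 1, _, 0, h => absurd h (by omega)
  | p + 1, q, r + 1, h => (cochain φ p q r (by omega)).left

lemma d_succ_apply (X : TopRep.{u} k G) (n : ℕ) (f : C(G, TopRep.resolutionX.{v, u, u} X n)) (x : G) :
    ((TopRep.d.{v, u, u} X (n + 1)).hom f : C(G, TopRep.resolutionX.{v, u, u} X (n + 1))) x =
      f - (TopRep.d.{v, u, u} X n).hom (f x) := rfl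

lemma d_rightIter (φ : GPairing A B C) (q r : ℕ) (h : q = r) (a : A)
    (b : TopRep.resolutionX.{v, u, u} B q) :
    (TopRep.d.{v, u, u} C r).hom ((φ.rightIter q r h).toLin a b) =
      (φ.rightIter (q + 1) (r + 1) (by omega)).toLin a ((TopRep.d.{v, u, u} B q).hom b) := by
  subst h
  induction q with
  | zero => rfl
  | succ q ih =>
    refine ContinuousMap.ext fun x => ?_
    refine (d_succ_apply C q _ x).trans ?_
    change C(G, TopRep.resolutionX.{v, u, u} B q) at b
    change _ - (TopRep.d.{v, u, u} C q).hom ((φ.rightIter q q rfl).toLin a (b x)) =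
      (φ.rightIter (q + 1) (q + 1) rfl).toLin a (b - (TopRep.d.{v, u, u} B q).hom (b x))
    rw [ih, map_sub]

/-- The Leibniz rule `d (f ∪ g) = d f ∪ g + (-1) ^ p • (f ∪ d g)`. -/
lemma d_cochain (φ : GPairing A B C) (p q r : ℕ) (h : p + q = r)
    (f : TopRep.resolutionX.{v, u, u} A (p + 1)) (g : TopRep.resolutionX.{v, u, u} B (q + 1)) :
    (TopRep.d.{v, u, u} C (r + 1)).hom ((φ.cochain p q r h).toLin f g) =
      (φ.cochain (p + 1) q (r + 1) (by omega)).toLin ((TopRep.d.{v, u, u} A (p + 1)).hom f) g +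
      (-1 : k) ^ p • (φ.cochain p (q + 1) (r + 1) (by omega)).toLin f
        ((TopRep.d.{v, u, u} B (q + 1)).hom g) := by
  induction p generalizing r with
  | zero =>
    obtain rfl : q = r := by omega
    change C(G, A) at f
    change C(G, TopRep.resolutionX.{v, u, u} B q) at g
    refine ContinuousMap.ext fun x => ?_
    refine (d_succ_apply C q _ x).trans ?_
    change _ - (TopRep.d.{v, u, u} C q).hom ((φ.rightIter q q rfl).toLin (f x) (g x)) =
      (φ.cochain 0 q q h).toLin (f - A.ρ.coind₁ι (f x)) g +
        (-1 : k) ^ 0 • (φ.rightIter (q + 1) (q + 1) rfl).toLin (f x)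
          (g - (TopRep.d.{v, u, u} B q).hom (g x))
    rw [d_rightIter, map_sub, map_sub, LinearMap.sub_apply, pow_zero, one_smul]
    change _ = _ - (φ.rightIter (q + 1) (q + 1) rfl).toLin (f x) g + _
    abel
  | succ p ih =>
    obtain ⟨r, rfl⟩ : ∃ s, r = s + 1 := ⟨r - 1, by omega⟩
    change C(G, TopRep.resolutionX.{v, u, u} A (p + 1)) at f
    refine ContinuousMap.ext fun x => ?_
    refine (d_succ_apply C (r + 1) _ x).trans ?_
    change _ - (TopRep.d.{v, u, u} C (r + 1)).hom ((φ.cochain p q r (by omega)).toLin (f x) g) =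
      (φ.cochain (p + 1) q (r + 1) h).toLin (f - (TopRep.d.{v, u, u} A (p + 1)).hom (f x)) g +
        (-1 : k) ^ (p + 1) • (φ.cochain p (q + 1) (r + 1) (by omega)).toLin (f x)
          ((TopRep.d.{v, u, u} B (q + 1)).hom g)
    rw [ih r (by omega), map_sub, LinearMap.sub_apply, pow_succ, mul_neg_one, neg_smul]
    abel

end GPairing

namespace ContCoh

open TopRep

/-- The `k`-module of homogeneous `n`-cochains of `G` with values in `A`. -/
def Cochain (A : TopRep.{u} k G) (n : ℕ) : Type u :=
  (resolutionX.{v, u, u} A (n + 1)).ρ.invariants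

instance (A : TopRep.{u} k G) (n : ℕ) : AddCommGroup (Cochain A n) :=
  inferInstanceAs (AddCommGroup (resolutionX.{v, u, u} A (n + 1)).ρ.invariants)

instance (A : TopRep.{u} k G) (n : ℕ) : Module k (Cochain A n) :=
  inferInstanceAs (Module k (resolutionX.{v, u, u} A (n + 1)).ρ.invariants)

/-- The differential on homogeneous cochains. -/
def dCochain (A : TopRep.{u} k G) (n : ℕ) : Cochain A n →ₗ[k] Cochain A (n + 1) :=
  (TopRep.d.{v, u, u} A (n + 1)).hom.mapInvariants.toLinearMap

/-- The `k`-module of homogeneous `n`-cocycles of `G` with values in `A`. -/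
def Cocycle (A : TopRep.{u} k G) (n : ℕ) : Submodule k (Cochain A n) :=
  LinearMap.ker (dCochain A n)

lemma homogeneousCochains_d_apply (A : TopRep.{u} k G) (n : ℕ) (z : Cochain A n) :
    ((homogeneousCochains.{v, u, u} A).d n (n + 1)).hom z = dCochain A n z :=
  Subtype.ext (homogeneousCochains.d_apply.{v, u, u} A n z)

lemma coe_dCochain (A : TopRep.{u} k G) (n : ℕ) (z : Cochain A n) :
    (dCochain A n z).1 = (TopRep.d.{v, u, u} A (n + 1)).hom z.1 := rfl

lemma mem_cocycle {A : TopRep.{u} k G} {n : ℕ} (z : Cochain A n) :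
    z ∈ Cocycle A n ↔ dCochain A n z = 0 := Iff.rfl

/-- The identification of cocycles with the kernel of the differential of the complex of
homogeneous cochains. -/
def cocycleToKer (A : TopRep.{u} k G) (n : ℕ) :
    Cocycle A n →ₗ[k] ((homogeneousCochains.{v, u, u} A).d n (n + 1)).hom.ker where
  toFun z := ⟨z.1, (homogeneousCochains_d_apply A n z.1).trans z.2⟩
  map_add' _ _ := rfl
  map_smul' _ _ := rfl

/-- The map sending a homogeneous cocycle to its cohomology class. -/
noncomputable def cls (A : TopRep.{u} k G) (n : ℕ) :
    Cocycle A n →ₗ[k] continuousCohomology.{v, u, u} n A :=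
  kerToHomology (homogeneousCochains.{v, u, u} A) n ∘ₗ cocycleToKer A n

lemma cls_surjective (A : TopRep.{u} k G) (n : ℕ) : Function.Surjective (cls A n) := by
  intro x
  obtain ⟨z, rfl⟩ := kerToHomology_surjective _ n x
  exact ⟨⟨z.1, (homogeneousCochains_d_apply A n z.1).symm.trans z.2⟩, rfl⟩

lemma cls_zero_eq_zero_iff {A : TopRep.{u} k G} (z : Cocycle A 0) :
    cls A 0 z = 0 ↔ z = 0 := by
  refine ⟨fun h => ?_, fun h => by rw [h, map_zero]⟩
  obtain ⟨i, y, hy⟩ := (kerToHomology_eq_zero_iff _ 0 (cocycleToKer A 0 z)).mp h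
  rw [(homogeneousCochains.{v, u, u} A).shape i 0 (by simp)] at hy
  exact Subtype.ext hy.symm

/-- A cocycle of positive degree has trivial class iff it is a coboundary. -/
lemma cls_succ_eq_zero_iff {A : TopRep.{u} k G} {n : ℕ} (z : Cocycle A (n + 1)) :
    cls A (n + 1) z = 0 ↔ ∃ y : Cochain A n, dCochain A n y = z.1 := by
  refine (kerToHomology_eq_zero_iff _ (n + 1) (cocycleToKer A (n + 1) z)).trans ⟨?_, ?_⟩
  · rintro ⟨i, y, hy⟩
    by_cases h : i = n
    · subst h
      exact ⟨y, (homogeneousCochains_d_apply A i y).symm.trans hy⟩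
    · rw [(homogeneousCochains.{v, u, u} A).shape i (n + 1) (by simpa using h)] at hy
      exact ⟨0, (map_zero _).trans hy⟩
  · rintro ⟨y, hy⟩
    exact ⟨n, y, (homogeneousCochains_d_apply A n y).trans hy⟩

variable {A B C : TopRep.{u} k G}

/-- The cup product of homogeneous cochains. -/
def cochainCup (φ : GPairing A B C) (p q r : ℕ) (h : p + q = r) :
    Cochain A p →ₗ[k] Cochain B q →ₗ[k] Cochain C r :=
  (φ.cochain p q r h).invariants

/-- The Leibniz rule for homogeneous cochains. -/
lemma d_cochainCup (φ : GPairing A B C) (p q r : ℕ) (h : p + q = r) (f : Cochain A p)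
    (g : Cochain B q) :
    dCochain C r (cochainCup φ p q r h f g) =
      cochainCup φ (p + 1) q (r + 1) (by omega) (dCochain A p f) g +
      (-1 : k) ^ p • cochainCup φ p (q + 1) (r + 1) (by omega) f (dCochain B q g) :=
  Subtype.ext (φ.d_cochain p q r h f.1 g.1)

/-- The cup product of cocycles. -/
def cocycleCup (φ : GPairing A B C) (p q r : ℕ) (h : p + q = r) :
    Cocycle A p →ₗ[k] Cocycle B q →ₗ[k] Cocycle C r :=
  LinearMap.mk₂ k
    (fun z w => ⟨cochainCup φ p q r h z.1 w.1, by
      rw [mem_cocycle, d_cochainCup, (mem_cocycle _).mp z.2, (mem_cocycle _).mp w.2, map_zero,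
        map_zero, LinearMap.zero_apply, smul_zero, add_zero]⟩)
    (by intros; ext1; simp) (by intros; ext1; simp) (by intros; ext1; simp)
    (by intros; ext1; simp)

lemma cls_cocycleCup_left (φ : GPairing A B C) (p q r : ℕ) (h : p + q = r)
    (z : Cocycle A p) (w : Cocycle B q) (hz : cls A p z = 0) :
    cls C r (cocycleCup φ p q r h z w) = 0 := by
  cases p with
  | zero => rw [(cls_zero_eq_zero_iff z).mp hz, map_zero, LinearMap.zero_apply, map_zero]
  | succ p =>
    obtain ⟨y, hy⟩ := (cls_succ_eq_zero_iff z).mp hz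
    obtain ⟨s, rfl⟩ : ∃ s, r = s + 1 := ⟨r - 1, by omega⟩
    refine (cls_succ_eq_zero_iff _).mpr ⟨cochainCup φ p q s (by omega) y w.1, ?_⟩
    rw [d_cochainCup, (mem_cocycle _).mp w.2, map_zero, smul_zero, add_zero, hy]
    rfl

lemma cls_cocycleCup_right (φ : GPairing A B C) (p q r : ℕ) (h : p + q = r)
    (z : Cocycle A p) (w : Cocycle B q) (hw : cls B q w = 0) :
    cls C r (cocycleCup φ p q r h z w) = 0 := by
  cases q with
  | zero => rw [(cls_zero_eq_zero_iff w).mp hw, map_zero, map_zero]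
  | succ q =>
    obtain ⟨y, hy⟩ := (cls_succ_eq_zero_iff w).mp hw
    obtain ⟨s, rfl⟩ : ∃ s, r = s + 1 := ⟨r - 1, by omega⟩
    refine (cls_succ_eq_zero_iff _).mpr
      ⟨(-1 : k) ^ p • cochainCup φ p q s (by omega) z.1 y, ?_⟩
    rw [map_smul, d_cochainCup, (mem_cocycle _).mp z.2, map_zero, LinearMap.zero_apply, zero_add,
      hy, smul_smul, ← mul_pow, neg_one_mul, neg_neg, one_pow, one_smul]
    rfl

/-- The cup product `Hᵖ(G, A) × H^q(G, B) → Hʳ(G, C)`, `p + q = r`, induced by a pairing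
`A × B → C`. It sends the classes of `z` and `w` to the class of `z ∪ w`. -/
noncomputable def cup (φ : GPairing A B C) (p q r : ℕ) (h : p + q = r) :
    continuousCohomology.{v, u, u} p A →ₗ[k] continuousCohomology.{v, u, u} q B →ₗ[k] continuousCohomology.{v, u, u} r C :=
  (LinearMap.liftQ₂ (LinearMap.ker (cls A p)) (LinearMap.ker (cls B q))
    ((cocycleCup φ p q r h).compr₂ (cls C r))
    (fun z hz => LinearMap.ext fun w => cls_cocycleCup_left φ p q r h z w hz)
    (fun w hw => LinearMap.ext fun z => cls_cocycleCup_right φ p q r h z w hw)).compl₁₂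
      ((cls A p).quotKerEquivOfSurjective (cls_surjective A p)).symm.toLinearMap
      ((cls B q).quotKerEquivOfSurjective (cls_surjective B q)).symm.toLinearMap

lemma cup_cls (φ : GPairing A B C) (p q r : ℕ) (h : p + q = r) (z : Cocycle A p)
    (w : Cocycle B q) :
    cup φ p q r h (cls A p z) (cls B q w) = cls C r (cocycleCup φ p q r h z w) := by
  have hz : ((cls A p).quotKerEquivOfSurjective (cls_surjective A p)).symm (cls A p z) =
      Submodule.Quotient.mk z := by
    rw [LinearEquiv.symm_apply_eq]
    rfl
  have hw : ((cls B q).quotKerEquivOfSurjective (cls_surjective B q)).symm (cls B q w) =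
      Submodule.Quotient.mk w := by
    rw [LinearEquiv.symm_apply_eq]
    rfl
  simp only [cup, LinearMap.compl₁₂_apply, LinearEquiv.coe_coe, hz, hw]
  rfl

end ContCoh
end CupProduct

section ProP

variable (G : Type u) [Group G] [TopologicalSpace G] [IsTopologicalGroup G]

/-- `G` is a pro-`p` group: a profinite group all of whose open normal subgroups have index a power
of `p`. -/
structure IsProPGroup (p : ℕ) : Prop where
  compactSpace : CompactSpace G
  totallyDisconnectedSpace : TotallyDisconnectedSpace G
  index_eq_pow (U : Subgroup G) : U.Normal → IsOpen (U : Set G) → ∃ m : ℕ, U.index = p ^ m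

/-- The trivial `G`-module `𝔽_p` with the discrete topology. -/
noncomputable abbrev trivialFp (p : ℕ) : TopRep.{u} ℤ G :=
  TopRep.of (ContRepresentation.trivial ℤ G (ULift.{u} (ZMod p)))

/-- The multiplication pairing `𝔽_p × 𝔽_p → 𝔽_p`. -/
noncomputable def mulPairing (p : ℕ) :
    GPairing (trivialFp G p) (trivialFp G p) (trivialFp G p) where
  toLin := LinearMap.mul ℤ (ULift.{u} (ZMod p))
  continuous_toLin := continuous_of_discreteTopology
  equivariant _ _ _ := rfl

variable {G}

/-- A discrete `G`-module: the topology is discrete and the action `G × A → A` is continuous. -/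
structure IsDiscreteGModule (A : TopRep.{u} ℤ G) : Prop where
  discreteTopology : DiscreteTopology A
  continuous_action : Continuous fun x : G × A => A.ρ x.1 x.2

variable (G)

/-- The cohomological dimension of `G`: the least `d` such that `Hⁱ(G, A) = 0` for every `i > d` and
every discrete torsion `G`-module `A`, and `∞` if there is no such `d`. -/
noncomputable def cohomologicalDimension : ℕ∞ :=
  sInf {d : ℕ∞ | ∀ i : ℕ, d < i → ∀ A : TopRep.{u} ℤ G, IsDiscreteGModule A →
    IsAddTorsion A → Subsingleton (continuousCohomology.{0, u, u} i A)}

/-- `G` is a generalized Poincaré duality pro-`p` group of dimension `n`: an infinite pro-`p` group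
with `Hⁿ(G, 𝔽_p) ≅ 𝔽_p` for which the cup product `Hⁱ(G, 𝔽_p) × Hʲ(G, 𝔽_p) → Hⁿ(G, 𝔽_p)` is
nondegenerate whenever `i + j = n`. -/
structure IsGPDGroup (p n : ℕ) : Prop where
  infinite : Infinite G
  isProPGroup : IsProPGroup G p
  nonempty_addEquiv : Nonempty (continuousCohomology.{0, u, u} n (trivialFp G p) ≃+ ZMod p)
  nondegenerate (i j : ℕ) (h : i + j = n) :
    (ContCoh.cup (mulPairing G p) i j n h).Nondegenerate

end ProP

universe w

/-! Write `n = d + 1`. Since `H^n(G, 𝔽_p) ≠ 0`, the dimension is at least `n`. The upper bound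
reduces to `H^{n+1}(G, 𝔽_p) = 0`. Over a pro-`p` group, a finite module of order divisible by `p`
contains a trivial `𝔽_p`, and cohomology in positive degrees is `p`-primary; this settles finite
modules (`eq_zero_of_finite`). Classes of a torsion module come from finite submodules, and
dimension shifting raises the degree (`eq_zero_of_isAddTorsion`).

The vanishing for `𝔽_p` rests on two facts about finite `𝔽_p[G]`-modules.

(1) `HasDuality.eq_zero_of_forall_hom`: `Hom_G(E, 𝔽_p)` separates `H^n(G, E)`. By induction on the
order of `E`, a class killed by all functionals comes from a trivial line `𝔽_p ⊆ E`. The hard case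
is that every functional on `E` kills the line while some functional on `E' = ker (ρ : E → 𝔽_p)`
does not. The connecting map `H^d(𝔽_p) → H^n(E')` is the cup product with the class `ξ` of `g ↦ g e
- e`, where `ρ e = 1` (`conn_cup`). The pairing of `H^1` and `H^d` yields `y` such that `ξ ∪ y`
comes from a nonzero class of the line. That class dies in `E`, and as `H^n(𝔽_p)` is
one-dimensional, so does every class of the line.

(2) `HasDuality.mapM_surjective`: `H^n` preserves surjections. As `G` is infinite, `A` embeds in a
finite module of functions on some `G ⧸ V` all of whose invariant functionals vanish on `A`. With
(1), a diagram chase shows that every nonzero `A → 𝔽_p` is onto on `H^n`; for a general `A → B`, (1)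
describes all functionals on `H^n(B)`.

Finally let `L` be the module of locally constant functions `G → 𝔽_p`. A class in `H^{n+1}(𝔽_p)` is
the image under the connecting map of some `c` in `H^n(L/𝔽_p)`. This `c` comes from a finite
submodule, so by (2) it lifts to `H^n(L)` and its image is zero. -/

theorem ContinuousMap.discreteTopology {X Y : Type*} [TopologicalSpace X] [CompactSpace X]
    [TopologicalSpace Y] [DiscreteTopology Y] : DiscreteTopology C(X, Y) := by
  rw [discreteTopology_iff_isOpen_singleton]
  intro f
  have hfin : (Set.range f).Finite := (isCompact_range f.continuous).finite_of_discrete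
  -- A continuous map with finitely many values is determined by its fibres; sending a compact fibre
  -- into an open point is an open condition.
  have h : ({f} : Set C(X, Y)) = ⋂ y ∈ Set.range f,
      {g : C(X, Y) | Set.MapsTo g (f ⁻¹' {y}) {y}} := by
    ext g
    simp only [Set.mem_singleton_iff, Set.mem_iInter, Set.mem_ofPred_eq]
    refine ⟨?_, fun h => ?_⟩
    · rintro rfl y _ x hx
      exact hx
    · ext x
      exact h (f x) ⟨x, rfl⟩ rfl
  rw [h]
  exact hfin.isOpen_biInter fun y _ => ContinuousMap.isOpen_setOfPred_mapsTo
    (((isClosed_discrete {y}).preimage f.continuous).isCompact) (isOpen_discrete _)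

/-! ### Functoriality and the long exact sequence for discrete coefficients. -/

namespace ContCoh

open TopRep ContRepresentation

variable {k : Type v} [CommRing k] [TopologicalSpace k]
variable {G : Type u} [Group G] [TopologicalSpace G] [IsTopologicalGroup G]
variable {A B C A' B' C' : TopRep.{u} k G}

/-- The map on the terms of the standard resolution induced by an intertwining map. -/
def resMap (f : A.ρ →ⁱL B.ρ) : (m : ℕ) →
    (resolutionX.{v, u, u} A m).ρ →ⁱL (resolutionX.{v, u, u} B m).ρ
  | 0 => f
  | m + 1 => coind₁Map (resMap f m)

lemma resMap_id (m : ℕ) (z : resolutionX.{v, u, u} A m) :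
    resMap (ContIntertwiningMap.id : A.ρ →ⁱL A.ρ) m z = z := by
  induction m with
  | zero => rfl
  | succ m ih => exact ContinuousMap.ext fun x => ih _

lemma resMap_comp (g : B.ρ →ⁱL C.ρ) (f : A.ρ →ⁱL B.ρ) (m : ℕ) (z : resolutionX.{v, u, u} A m) :
    resMap (g.comp f) m z = resMap g m (resMap f m z) := by
  induction m with
  | zero => rfl
  | succ m ih => exact ContinuousMap.ext fun x => ih _

lemma resMap_sub (f g : A.ρ →ⁱL B.ρ) (m : ℕ) (z : resolutionX.{v, u, u} A m) :
    resMap (f - g) m z = resMap f m z - resMap g m z := by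
  induction m with
  | zero => rfl
  | succ m ih => exact ContinuousMap.ext fun x => ih _

lemma resMap_zero (m : ℕ) (z : resolutionX.{v, u, u} A m) :
    resMap (0 : A.ρ →ⁱL B.ρ) m z = 0 := by
  induction m with
  | zero => rfl
  | succ m ih => exact ContinuousMap.ext fun x => ih _

lemma resMap_injective (f : A.ρ →ⁱL B.ρ) (hf : Function.Injective f) (m : ℕ) :
    Function.Injective (resMap f m) := by
  induction m with
  | zero => exact hf
  | succ m ih =>
    intro a b h
    exact ContinuousMap.ext fun x => ih (DFunLike.congr_fun h x)

lemma resMap_d (f : A.ρ →ⁱL B.ρ) (m : ℕ) (z : resolutionX.{v, u, u} A m) :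
    resMap f (m + 1) ((TopRep.d.{v, u, u} A m).hom z) =
      (TopRep.d.{v, u, u} B m).hom (resMap f m z) := by
  induction m with
  | zero => rfl
  | succ m ih =>
    refine ContinuousMap.ext fun x => ?_
    change C(G, resolutionX.{v, u, u} A m) at z
    change resMap f (m + 1) (z - (TopRep.d.{v, u, u} A m).hom (z x)) =
      resMap f (m + 1) z - (TopRep.d.{v, u, u} B m).hom (resMap f m (z x))
    rw [map_sub, ih]

/-- A representation on a discrete module such that the action `G × A → A` is continuous. -/
structure IsDiscreteRep (A : TopRep.{u} k G) : Prop where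
  discreteTopology : DiscreteTopology A
  continuous_action : Continuous fun x : G × A => A.ρ x.1 x.2

lemma isDiscreteRep_coind₁ [CompactSpace G] (hA : IsDiscreteRep A) :
    IsDiscreteRep A.coind₁ := by
  have := hA.discreteTopology
  have hd : DiscreteTopology C(G, A) := ContinuousMap.discreteTopology
  refine ⟨hd, ?_⟩
  change Continuous fun x : G × C(G, A) => A.ρ.coind₁ x.1 x.2
  rw [continuous_prod_of_discrete_right]
  intro f
  refine ContinuousMap.continuous_of_continuous_uncurry _ ?_
  change Continuous fun x : G × G => A.ρ x.1 (f (x.1⁻¹ * x.2))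
  exact hA.continuous_action.comp (continuous_fst.prodMk (f.continuous.comp
    ((continuous_fst.inv).mul continuous_snd)))

lemma isDiscreteRep_resolutionX [CompactSpace G] (hA : IsDiscreteRep A) (m : ℕ) :
    IsDiscreteRep (resolutionX.{v, u, u} A m) := by
  induction m with
  | zero => exact hA
  | succ m ih => exact isDiscreteRep_coind₁ ih

/-- On a discrete module any set-theoretic section is continuous, so composing with it lifts
continuous functions. -/
lemma resMap_surjective [CompactSpace G] (hB : IsDiscreteRep B) (q : A.ρ →ⁱL B.ρ)
    (hq : Function.Surjective q) (m : ℕ) : Function.Surjective (resMap q m) := by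
  induction m with
  | zero => exact hq
  | succ m ih =>
    intro (z : C(G, resolutionX.{v, u, u} B m))
    have := (isDiscreteRep_resolutionX hB m).discreteTopology
    obtain ⟨s, hs⟩ := ih.hasRightInverse
    exact ⟨(⟨s, continuous_of_discreteTopology⟩ : C(_, _)).comp z,
      ContinuousMap.ext fun x => hs (z x)⟩

lemma resMap_exact [CompactSpace G] (hB : IsDiscreteRep B) (i : A.ρ →ⁱL B.ρ) (q : B.ρ →ⁱL C.ρ)
    (h : Function.Exact i q) (m : ℕ) : Function.Exact (resMap i m) (resMap q m) := by
  induction m with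
  | zero => exact h
  | succ m ih =>
    intro (z : C(G, resolutionX.{v, u, u} B m))
    have := (isDiscreteRep_resolutionX hB m).discreteTopology
    constructor
    · intro hz
      have h0 : ∀ x, ∃ a, resMap i m a = z x := fun x => (ih _).mp (DFunLike.congr_fun hz x)
      classical
      -- Only the values of `z` need preimages; the default `0` is never met.
      let s : resolutionX.{v, u, u} B m → resolutionX.{v, u, u} A m := fun b =>
        if hb : ∃ a, resMap i m a = b then hb.choose else 0
      have hs : ∀ x, resMap i m (s (z x)) = z x := fun x => by
        simp only [s, dif_pos (h0 x)]
        exact (h0 x).choose_spec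
      exact ⟨(⟨s, continuous_of_discreteTopology⟩ : C(_, _)).comp z,
        ContinuousMap.ext fun x => hs x⟩
    · rintro ⟨a, rfl⟩
      exact ContinuousMap.ext fun x => (ih _).mpr ⟨_, rfl⟩

/-- The map on homogeneous cochains induced by an intertwining map. -/
def mapCochain (f : A.ρ →ⁱL B.ρ) (n : ℕ) : Cochain A n →ₗ[k] Cochain B n :=
  (resMap f (n + 1)).mapInvariants.toLinearMap

lemma dCochain_mapCochain (f : A.ρ →ⁱL B.ρ) (n : ℕ) (z : Cochain A n) :
    dCochain B n (mapCochain f n z) = mapCochain f (n + 1) (dCochain A n z) :=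
  Subtype.ext (resMap_d f (n + 1) z.1).symm

lemma dCochain_dCochain (n : ℕ) (z : Cochain A n) : dCochain A (n + 1) (dCochain A n z) = 0 :=
  Subtype.ext (ConcreteCategory.congr_hom (TopRep.d_comp_d.{v, u, u} A (n + 1)) z.1)

lemma mapCochain_comp (g : B.ρ →ⁱL C.ρ) (f : A.ρ →ⁱL B.ρ) (n : ℕ) (z : Cochain A n) :
    mapCochain (g.comp f) n z = mapCochain g n (mapCochain f n z) :=
  Subtype.ext (resMap_comp g f (n + 1) z.1)

lemma mapCochain_injective (f : A.ρ →ⁱL B.ρ) (hf : Function.Injective f) (n : ℕ) :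
    Function.Injective (mapCochain f n) := fun _ _ h =>
  Subtype.ext (resMap_injective f hf (n + 1) (congrArg Subtype.val h))

lemma mapCochain_surjective [CompactSpace G] (hA : IsDiscreteRep A) (hB : IsDiscreteRep B)
    (q : A.ρ →ⁱL B.ρ) (hq : Function.Surjective q) (n : ℕ) :
    Function.Surjective (mapCochain q n) := by
  rintro ⟨(c : C(G, resolutionX.{v, u, u} B n)), hc⟩
  obtain ⟨y, hy⟩ := resMap_surjective hB q hq n (c 1)
  have hX := isDiscreteRep_resolutionX hA n
  -- An invariant cochain is determined by its value at `1`. A lift `y` of `c 1` is spread over `G`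
  -- by the action, which is invariant for any `y`.
  refine ⟨⟨(⟨fun g => (resolutionX.{v, u, u} A n).ρ g y,
    hX.continuous_action.comp (continuous_id.prodMk continuous_const)⟩ : C(G, _)), ?_⟩, ?_⟩
  · intro g
    refine ContinuousMap.ext fun x => ?_
    change (resolutionX.{v, u, u} A n).ρ g ((resolutionX.{v, u, u} A n).ρ (g⁻¹ * x) y) =
      (resolutionX.{v, u, u} A n).ρ x y
    rw [← mul_apply_eq_comp, ← map_mul, mul_inv_cancel_left]
  · refine Subtype.ext (ContinuousMap.ext fun x => ?_)
    change resMap q n ((resolutionX.{v, u, u} A n).ρ x y) = c x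
    rw [(resMap q n).isIntertwining, hy]
    have := DFunLike.congr_fun (hc x) x
    change (resolutionX.{v, u, u} B n).ρ x (c (x⁻¹ * x)) = c x at this
    rwa [inv_mul_cancel] at this

lemma mapCochain_exact [CompactSpace G] (hB : IsDiscreteRep B) (i : A.ρ →ⁱL B.ρ)
    (q : B.ρ →ⁱL C.ρ) (hi : Function.Injective i) (h : Function.Exact i q) (n : ℕ) :
    Function.Exact (mapCochain i n) (mapCochain q n) := by
  intro z
  constructor
  · intro hz
    obtain ⟨a, ha⟩ := (resMap_exact hB i q h (n + 1) z.1).mp (congrArg Subtype.val hz)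
    refine ⟨⟨a, fun g => resMap_injective i hi (n + 1) ?_⟩, Subtype.ext ha⟩
    rw [(resMap i (n + 1)).isIntertwining, ha, z.2 g]
  · rintro ⟨a, rfl⟩
    exact Subtype.ext ((resMap_exact hB i q h (n + 1) _).mpr ⟨a.1, rfl⟩)

/-- The map on homogeneous cocycles induced by an intertwining map. -/
def mapCocycle (f : A.ρ →ⁱL B.ρ) (n : ℕ) : Cocycle A n →ₗ[k] Cocycle B n :=
  (mapCochain f n).restrict fun z hz => by
    rw [mem_cocycle] at hz ⊢
    rw [dCochain_mapCochain, hz, map_zero]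

lemma coe_mapCocycle (f : A.ρ →ⁱL B.ρ) (n : ℕ) (z : Cocycle A n) :
    (mapCocycle f n z).1 = mapCochain f n z.1 := rfl

lemma cls_mapCocycle_eq_zero (f : A.ρ →ⁱL B.ρ) (n : ℕ) (z : Cocycle A n) (hz : cls A n z = 0) :
    cls B n (mapCocycle f n z) = 0 := by
  cases n with
  | zero => rw [(cls_zero_eq_zero_iff z).mp hz, map_zero, map_zero]
  | succ n =>
    obtain ⟨y, hy⟩ := (cls_succ_eq_zero_iff z).mp hz
    refine (cls_succ_eq_zero_iff _).mpr ⟨mapCochain f n y, ?_⟩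
    rw [dCochain_mapCochain, hy, coe_mapCocycle]

/-- The continuous cohomology of a topological representation over `k`. -/
noncomputable abbrev H (A : TopRep.{u} k G) (n : ℕ) := continuousCohomology.{v, u, u} n A

/-- The map on cohomology induced by an intertwining map. -/
noncomputable def mapH (f : A.ρ →ⁱL B.ρ) (n : ℕ) : H A n →ₗ[k] H B n :=
  (LinearMap.ker (cls A n)).liftQ (cls B n ∘ₗ mapCocycle f n) (cls_mapCocycle_eq_zero f n) ∘ₗ
    ((cls A n).quotKerEquivOfSurjective (cls_surjective A n)).symm.toLinearMap

lemma mapH_cls (f : A.ρ →ⁱL B.ρ) (n : ℕ) (z : Cocycle A n) :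
    mapH f n (cls A n z) = cls B n (mapCocycle f n z) := by
  have hz : ((cls A n).quotKerEquivOfSurjective (cls_surjective A n)).symm (cls A n z) =
      Submodule.Quotient.mk z := by
    rw [LinearEquiv.symm_apply_eq]
    rfl
  rw [mapH, LinearMap.comp_apply, LinearEquiv.coe_coe, hz]
  rfl

lemma mapH_id (n : ℕ) (x : H A n) : mapH (ContIntertwiningMap.id : A.ρ →ⁱL A.ρ) n x = x := by
  obtain ⟨z, rfl⟩ := cls_surjective A n x
  rw [mapH_cls]
  exact congrArg _ (Subtype.ext (Subtype.ext (resMap_id (n + 1) z.1.1)))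

lemma mapH_comp (g : B.ρ →ⁱL C.ρ) (f : A.ρ →ⁱL B.ρ) (n : ℕ) (x : H A n) :
    mapH (g.comp f) n x = mapH g n (mapH f n x) := by
  obtain ⟨z, rfl⟩ := cls_surjective A n x
  rw [mapH_cls, mapH_cls, mapH_cls]
  exact congrArg _ (Subtype.ext (mapCochain_comp g f n z.1))

lemma mapH_sub (f g : A.ρ →ⁱL B.ρ) (n : ℕ) (x : H A n) :
    mapH (f - g) n x = mapH f n x - mapH g n x := by
  obtain ⟨z, rfl⟩ := cls_surjective A n x
  rw [mapH_cls, mapH_cls, mapH_cls, ← map_sub]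
  exact congrArg _ (Subtype.ext (Subtype.ext (resMap_sub f g (n + 1) z.1.1)))

lemma mapH_zero (n : ℕ) (x : H A n) : mapH (0 : A.ρ →ⁱL B.ρ) n x = 0 := by
  obtain ⟨z, rfl⟩ := cls_surjective A n x
  rw [mapH_cls, ← map_zero (cls B n)]
  exact congrArg _ (Subtype.ext (Subtype.ext (resMap_zero (n + 1) z.1.1)))

/-- The connecting homomorphism of `A → B → C`, as a relation between `Hⁿ(G, C)` and
`Hⁿ⁺¹(G, A)`. -/
def Conn (i : A.ρ →ⁱL B.ρ) (q : B.ρ →ⁱL C.ρ) (n : ℕ) (c : H C n) (a : H A (n + 1)) : Prop :=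
  ∃ (z : Cocycle C n) (w : Cocycle A (n + 1)) (b : Cochain B n), cls C n z = c ∧
    cls A (n + 1) w = a ∧ mapCochain q n b = z.1 ∧ dCochain B n b = mapCochain i (n + 1) w.1

lemma Conn.sub {i : A.ρ →ⁱL B.ρ} {q : B.ρ →ⁱL C.ρ} {n : ℕ} {c c' : H C n} {a a' : H A (n + 1)}
    (h : Conn i q n c a) (h' : Conn i q n c' a') : Conn i q n (c - c') (a - a') := by
  obtain ⟨z, w, b, rfl, rfl, h1, h2⟩ := h
  obtain ⟨z', w', b', rfl, rfl, h1', h2'⟩ := h'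
  exact ⟨z - z', w - w', b - b', by simp, by simp, by simp [h1, h1'], by simp [h2, h2']⟩

lemma Conn.map {i : A.ρ →ⁱL B.ρ} {q : B.ρ →ⁱL C.ρ} {i' : A'.ρ →ⁱL B'.ρ} {q' : B'.ρ →ⁱL C'.ρ}
    {n : ℕ} {c : H C n} {a : H A (n + 1)} (h : Conn i q n c a) (α : A.ρ →ⁱL A'.ρ)
    (β : B.ρ →ⁱL B'.ρ) (γ : C.ρ →ⁱL C'.ρ) (h1 : β.comp i = i'.comp α)
    (h2 : γ.comp q = q'.comp β) : Conn i' q' n (mapH γ n c) (mapH α (n + 1) a) := by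
  obtain ⟨z, w, b, rfl, rfl, hz, hw⟩ := h
  refine ⟨mapCocycle γ n z, mapCocycle α (n + 1) w, mapCochain β n b, (mapH_cls _ _ _).symm,
    (mapH_cls _ _ _).symm, ?_, ?_⟩
  · rw [coe_mapCocycle, ← hz, ← mapCochain_comp, ← mapCochain_comp, h2]
  · rw [coe_mapCocycle, dCochain_mapCochain, hw, ← mapCochain_comp, ← mapCochain_comp, h1]

lemma Conn.mapH_eq_zero {i : A.ρ →ⁱL B.ρ} {q : B.ρ →ⁱL C.ρ} {n : ℕ} {c : H C n} {a : H A (n + 1)}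
    (h : Conn i q n c a) : mapH i (n + 1) a = 0 := by
  obtain ⟨z, w, b, rfl, rfl, hz, hw⟩ := h
  rw [mapH_cls]
  exact (cls_succ_eq_zero_iff _).mpr ⟨b, hw⟩

/-- The data of a short exact sequence of discrete representations. -/
structure IsSES (i : A.ρ →ⁱL B.ρ) (q : B.ρ →ⁱL C.ρ) : Prop where
  discrete_left : IsDiscreteRep A
  discrete_mid : IsDiscreteRep B
  discrete_right : IsDiscreteRep C
  injective : Function.Injective i
  exact : Function.Exact i q
  surjective : Function.Surjective q

section LES

variable {i : A.ρ →ⁱL B.ρ} {q : B.ρ →ⁱL C.ρ} {n : ℕ}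

lemma IsSES.exists_lift [CompactSpace G] (S : IsSES i q) (b : Cochain B n)
    (hb : mapCochain q n b = 0) :
    ∃ a, mapCochain i n a = b :=
  (mapCochain_exact S.discrete_mid i q S.injective S.exact n b).mp hb

lemma IsSES.mapCochain_comp_eq_zero [CompactSpace G] (S : IsSES i q) (a : Cochain A n) :
    mapCochain q n (mapCochain i n a) = 0 :=
  (mapCochain_exact S.discrete_mid i q S.injective S.exact n _).mpr ⟨a, rfl⟩

lemma IsSES.isCocycle (S : IsSES i q) (a : Cochain A n) (ha : dCochain B n (mapCochain i n a) = 0) :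
    a ∈ Cocycle A n := by
  rw [dCochain_mapCochain] at ha
  exact (mem_cocycle a).mpr (mapCochain_injective i S.injective _ (ha.trans (map_zero _).symm))

lemma IsSES.exists_conn [CompactSpace G] (S : IsSES i q) (c : H C n) : ∃ a, Conn i q n c a := by
  obtain ⟨z, rfl⟩ := cls_surjective C n c
  obtain ⟨b, hb⟩ := mapCochain_surjective S.discrete_mid S.discrete_right q S.surjective n z.1
  obtain ⟨w, hw⟩ := S.exists_lift (dCochain B n b) (by
    rw [← dCochain_mapCochain, hb]
    exact z.2)
  exact ⟨_, z, ⟨w, S.isCocycle w (by rw [hw, dCochain_dCochain])⟩, b, rfl, rfl, hb, hw.symm⟩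

lemma IsSES.exact_mid [CompactSpace G] (S : IsSES i q) (b : H B n) (hb : mapH q n b = 0) :
    ∃ a, mapH i n a = b := by
  obtain ⟨z, rfl⟩ := cls_surjective B n b
  rw [mapH_cls] at hb
  -- A coboundary is subtracted so that the representative vanishes in `C` as a cochain; in degree
  -- `0` it vanishes already.
  have key : ∃ b' : Cocycle B n, cls B n b' = cls B n z ∧ mapCochain q n b'.1 = 0 := by
    cases n with
    | zero =>
      exact ⟨z, rfl, congrArg Subtype.val ((cls_zero_eq_zero_iff _).mp hb)⟩
    | succ n =>
      obtain ⟨y, hy⟩ := (cls_succ_eq_zero_iff _).mp hb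
      obtain ⟨y', rfl⟩ := mapCochain_surjective S.discrete_mid S.discrete_right q S.surjective n y
      have hc : dCochain B n y' ∈ Cocycle B (n + 1) := dCochain_dCochain n y'
      refine ⟨z - ⟨_, hc⟩, ?_, ?_⟩
      · rw [map_sub, (cls_succ_eq_zero_iff ⟨_, hc⟩).mpr ⟨y', rfl⟩, sub_zero]
      · rw [Submodule.coe_sub, map_sub, ← dCochain_mapCochain, hy, coe_mapCocycle, sub_self]
  obtain ⟨b', hb', hq⟩ := key
  obtain ⟨a, ha⟩ := S.exists_lift b'.1 hq
  refine ⟨cls A n ⟨a, S.isCocycle a (by rw [ha]; exact b'.2)⟩, ?_⟩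
  rw [mapH_cls, ← hb']
  exact congrArg _ (Subtype.ext ha)

lemma IsSES.exists_conn_of_mapH_eq_zero [CompactSpace G] (S : IsSES i q) (a : H A (n + 1))
    (ha : mapH i (n + 1) a = 0) :
    ∃ c, Conn i q n c a := by
  obtain ⟨w, rfl⟩ := cls_surjective A (n + 1) a
  rw [mapH_cls] at ha
  obtain ⟨b, hb⟩ := (cls_succ_eq_zero_iff _).mp ha
  rw [coe_mapCocycle] at hb
  refine ⟨cls C n ⟨mapCochain q n b, ?_⟩, _, w, b, rfl, rfl, rfl, hb⟩
  rw [mem_cocycle, dCochain_mapCochain, hb, S.mapCochain_comp_eq_zero]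

lemma conn_mapH (b : H B n) : Conn i q n (mapH q n b) 0 := by
  obtain ⟨z, rfl⟩ := cls_surjective B n b
  refine ⟨mapCocycle q n z, 0, z.1, (mapH_cls _ _ _).symm, map_zero _, rfl, ?_⟩
  rw [(mem_cocycle _).mp z.2]
  exact (map_zero _).symm

lemma IsSES.eq_zero_of_conn_zero [CompactSpace G] (S : IsSES i q) (a : H A (n + 1))
    (h : Conn i q n 0 a) : a = 0 := by
  obtain ⟨z, w, b, hz, rfl, hq, hb⟩ := h
  have key : ∃ b' : Cochain B n, dCochain B n b' = dCochain B n b ∧ mapCochain q n b' = 0 := by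
    cases n with
    | zero =>
      rw [(cls_zero_eq_zero_iff _).mp hz] at hq
      exact ⟨b, rfl, hq⟩
    | succ n =>
      obtain ⟨y, hy⟩ := (cls_succ_eq_zero_iff _).mp hz
      obtain ⟨y', rfl⟩ := mapCochain_surjective S.discrete_mid S.discrete_right q S.surjective n y
      refine ⟨b - dCochain B n y', by rw [map_sub, dCochain_dCochain, sub_zero], ?_⟩
      rw [map_sub, ← dCochain_mapCochain, hy, hq, sub_self]
  obtain ⟨b', hb', hq'⟩ := key
  obtain ⟨a, rfl⟩ := S.exists_lift b' hq'
  refine (cls_succ_eq_zero_iff _).mpr ⟨a, mapCochain_injective i S.injective _ ?_⟩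
  rw [← dCochain_mapCochain, hb', hb]

lemma IsSES.conn_unique [CompactSpace G] (S : IsSES i q) {c : H C n} {a a' : H A (n + 1)}
    (h : Conn i q n c a) (h' : Conn i q n c a') :
    a = a' :=
  sub_eq_zero.mp (S.eq_zero_of_conn_zero _ (by simpa using h.sub h'))

end LES

end ContCoh

/-! ### Coinduced modules, naturality of cup products, and connecting maps as cup products. -/

namespace ContCoh

open TopRep ContRepresentation

variable {k : Type v} [CommRing k] [TopologicalSpace k]
variable {G : Type u} [Group G] [TopologicalSpace G] [IsTopologicalGroup G]
variable {A B C A' B' C' : TopRep.{u} k G}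

/-- The identification of `C(G, …, C(G, A))` with functions in one variable less with values in
`C(G, A)`. -/
def shift (A : TopRep.{u} k G) : (m : ℕ) →
    (resolutionX.{v, u, u} A (m + 1)).ρ →ⁱL (resolutionX.{v, u, u} A.coind₁ m).ρ
  | 0 => ContIntertwiningMap.id
  | m + 1 => coind₁Map (shift A m)

/-- The extra term is the face omitting the last variable: it is constant in the variable that
`shift` moves into the coefficients. -/
lemma shift_d (m : ℕ) (v : resolutionX.{v, u, u} A (m + 1)) :
    shift A (m + 1) ((TopRep.d.{v, u, u} A (m + 1)).hom v) =
      (TopRep.d.{v, u, u} A.coind₁ m).hom (shift A m v) +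
        (-1 : k) ^ (m + 1) • resMap A.ρ.coind₁ι (m + 1) v := by
  induction m with
  | zero =>
    refine ContinuousMap.ext fun x => ContinuousMap.ext fun y => ?_
    change C(G, A) at v
    change v y - v x = v y + (-1 : k) ^ (0 + 1) • v x
    rw [zero_add, pow_one, neg_one_smul, sub_eq_add_neg]
  | succ m ih =>
    refine ContinuousMap.ext fun x => ?_
    change C(G, resolutionX.{v, u, u} A (m + 1)) at v
    change shift A (m + 1) (v - (TopRep.d.{v, u, u} A (m + 1)).hom (v x)) =
      (shift A (m + 1) v - (TopRep.d.{v, u, u} A.coind₁ m).hom (shift A m (v x))) +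
        (-1 : k) ^ (m + 1 + 1) • resMap A.ρ.coind₁ι (m + 1) (v x)
    rw [map_sub, ih, pow_succ _ (m + 1), mul_neg_one, neg_smul]
    abel

/-- Classes of positive degree vanish in the coinduced module. -/
lemma mapH_coind₁ι_eq_zero (n : ℕ) (x : H A (n + 1)) :
    mapH (B := A.coind₁) A.ρ.coind₁ι (n + 1) x = 0 := by
  obtain ⟨z, rfl⟩ := cls_surjective A (n + 1) x
  rw [mapH_cls]
  -- By `shift_d`, the cocycle itself, read in one variable less with values in `C(G, A)`, bounds
  -- its image up to sign.
  let y : Cochain A.coind₁ n := (shift A (n + 1)).mapInvariants z.1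
  refine (cls_succ_eq_zero_iff _).mpr ⟨(-1 : k) ^ (n + 1) • y, Subtype.ext ?_⟩
  have h := shift_d (n + 1) z.1.1
  have hz : (TopRep.d.{v, u, u} A (n + 1 + 1)).hom z.1.1 = 0 := congrArg Subtype.val z.2
  rw [hz, map_zero] at h
  rw [(dCochain A.coind₁ n).map_smul]
  change (-1 : k) ^ (n + 1) • (TopRep.d.{v, u, u} A.coind₁ (n + 1)).hom (shift A (n + 1) z.1.1) =
    resMap A.ρ.coind₁ι (n + 1 + 1) z.1.1
  rw [eq_neg_of_add_eq_zero_left h.symm, pow_succ _ (n + 1), mul_neg_one, neg_smul, neg_neg,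
    smul_smul, ← mul_pow, neg_one_mul, neg_neg, one_pow, one_smul]

lemma rightIter_resMap (φ : GPairing A B C) (φ' : GPairing A' B' C') (f : A.ρ →ⁱL A'.ρ)
    (g : B.ρ →ⁱL B'.ρ) (h : C.ρ →ⁱL C'.ρ)
    (hH : ∀ a b, φ'.toLin (f a) (g b) = h (φ.toLin a b)) (q r : ℕ) (e : q = r) (a : A)
    (b : resolutionX.{v, u, u} B q) :
    (φ'.rightIter q r e).toLin (f a) (resMap g q b) =
      resMap h r ((φ.rightIter q r e).toLin a b) := by
  subst e
  induction q with
  | zero => exact hH a b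
  | succ q ih => exact ContinuousMap.ext fun x => ih _

lemma cochain_resMap (φ : GPairing A B C) (φ' : GPairing A' B' C') (f : A.ρ →ⁱL A'.ρ)
    (g : B.ρ →ⁱL B'.ρ) (h : C.ρ →ⁱL C'.ρ)
    (hH : ∀ a b, φ'.toLin (f a) (g b) = h (φ.toLin a b)) (p q r : ℕ) (e : p + q = r)
    (a : resolutionX.{v, u, u} A (p + 1)) (b : resolutionX.{v, u, u} B (q + 1)) :
    (φ'.cochain p q r e).toLin (resMap f (p + 1) a) (resMap g (q + 1) b) =
      resMap h (r + 1) ((φ.cochain p q r e).toLin a b) := by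
  induction p generalizing r with
  | zero => exact ContinuousMap.ext fun x => rightIter_resMap φ φ' f g h hH q r (by omega) _ _
  | succ p ih =>
    obtain ⟨r, rfl⟩ : ∃ s, r = s + 1 := ⟨r - 1, by omega⟩
    exact ContinuousMap.ext fun x => ih r (by omega) _

lemma cochainCup_mapCochain (φ : GPairing A B C) (φ' : GPairing A' B' C') (f : A.ρ →ⁱL A'.ρ)
    (g : B.ρ →ⁱL B'.ρ) (h : C.ρ →ⁱL C'.ρ)
    (hH : ∀ a b, φ'.toLin (f a) (g b) = h (φ.toLin a b)) (p q r : ℕ) (e : p + q = r)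
    (a : Cochain A p) (b : Cochain B q) :
    cochainCup φ' p q r e (mapCochain f p a) (mapCochain g q b) =
      mapCochain h r (cochainCup φ p q r e a b) :=
  Subtype.ext (cochain_resMap φ φ' f g h hH p q r e a.1 b.1)

lemma cup_mapH (φ : GPairing A B C) (φ' : GPairing A' B' C') (f : A.ρ →ⁱL A'.ρ)
    (g : B.ρ →ⁱL B'.ρ) (h : C.ρ →ⁱL C'.ρ)
    (hH : ∀ a b, φ'.toLin (f a) (g b) = h (φ.toLin a b)) (p q r : ℕ) (e : p + q = r)
    (x : H A p) (y : H B q) :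
    cup φ' p q r e (mapH f p x) (mapH g q y) = mapH h r (cup φ p q r e x y) := by
  obtain ⟨z, rfl⟩ := cls_surjective A p x
  obtain ⟨w, rfl⟩ := cls_surjective B q y
  rw [mapH_cls, mapH_cls, cup_cls, cup_cls, mapH_cls]
  exact congrArg _ (Subtype.ext (cochainCup_mapCochain φ φ' f g h hH p q r e z.1 w.1))

/-- The homogeneous `0`-cochain `x ↦ x e`. -/
def orbitCochain (hA : IsDiscreteRep A) (e : A) : Cochain A 0 :=
  ⟨(⟨fun g => A.ρ g e, hA.continuous_action.comp (continuous_id.prodMk continuous_const)⟩ :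
    C(G, A)), fun g => ContinuousMap.ext fun x => by
      change A.ρ g (A.ρ (g⁻¹ * x) e) = A.ρ x e
      rw [← mul_apply_eq_comp, ← map_mul, mul_inv_cancel_left]⟩

section ConnCup

variable {i : A.ρ →ⁱL B.ρ} {q : B.ρ →ⁱL C.ρ}

/-- The cocycle is `(x, y) ↦ y e - x e`, which takes values in `A` because `q e` is invariant. -/
lemma IsSES.exists_cocycle [CompactSpace G] (S : IsSES i q) (e : B)
    (he : ∀ g, C.ρ g (q e) = q e) :
    ∃ ψ : Cocycle A 1, mapCochain i 1 ψ.1 = dCochain B 0 (orbitCochain S.discrete_mid e) := by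
  obtain ⟨ψ, hψ⟩ := S.exists_lift (dCochain B 0 (orbitCochain S.discrete_mid e)) (by
    rw [← dCochain_mapCochain]
    refine Subtype.ext (ContinuousMap.ext fun x => ContinuousMap.ext fun y => ?_)
    change q (B.ρ y e) - q (B.ρ x e) = 0
    rw [q.isIntertwining, q.isIntertwining, he, he, sub_self])
  exact ⟨⟨ψ, S.isCocycle ψ (by rw [hψ, dCochain_dCochain])⟩, hψ⟩

/-- Used with `a = x e`: pairing with `a` is a section of `q` on coefficients, hence pointwise on
functions of several variables. -/
lemma resMap_rightIter (φ : GPairing B C B) (q : B.ρ →ⁱL C.ρ) (a : B)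
    (ha : ∀ t, q (φ.toLin a t) = t) (n r : ℕ) (h : n = r) (w : resolutionX.{v, u, u} C n) :
    h ▸ resMap q r ((φ.rightIter n r h).toLin a w) = w := by
  subst h
  induction n with
  | zero => exact ha w
  | succ n ih => exact ContinuousMap.ext fun x => ih _

/-- The connecting homomorphism is the cup product with the class of `x ↦ x e - e`. -/
lemma conn_cup (hB : IsDiscreteRep B) (e : B) (φA : GPairing A C A) (φB : GPairing B C B)
    (hφ : ∀ a t, φB.toLin (i a) t = i (φA.toLin a t))
    (he : ∀ g t, q (φB.toLin (B.ρ g e) t) = t) (ψ : Cocycle A 1)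
    (hψ : mapCochain i 1 ψ.1 = dCochain B 0 (orbitCochain hB e)) (n : ℕ) (y : H C n) :
    Conn i q n y (cup φA 1 n (n + 1) (by omega) (cls A 1 ψ) y) := by
  obtain ⟨z, rfl⟩ := cls_surjective C n y
  -- The cochain `(x ↦ x e) ∪ z` lifts `z`. As `z` is a cocycle, the Leibniz rule gives it the
  -- differential `d(x ↦ x e) ∪ z = i (ψ ∪ z)`.
  refine ⟨z, cocycleCup φA 1 n (n + 1) (by omega) ψ z,
    cochainCup φB 0 n n (by omega) (orbitCochain hB e) z.1, rfl, (cup_cls ..).symm, ?_, ?_⟩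
  · refine Subtype.ext (ContinuousMap.ext fun x => ?_)
    exact resMap_rightIter φB q (B.ρ x e) (he x) n n rfl _
  · rw [d_cochainCup, (mem_cocycle _).mp z.2, map_zero, smul_zero, add_zero, ← hψ]
    have := cochainCup_mapCochain φA φB i ContIntertwiningMap.id i hφ 1 n (n + 1) (by omega) ψ.1 z.1
    rw [show mapCochain (ContIntertwiningMap.id : C.ρ →ⁱL C.ρ) n z.1 = z.1 from
      Subtype.ext (resMap_id (n + 1) z.1.1)] at this
    exact this

/-- If the class of `x ↦ x e - e` dies under a map `r` to a trivial module, then `r` vanishes on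
all `x e - e`. -/
lemma eq_zero_of_mapH_cls_eq_zero (hB : IsDiscreteRep B) (hi : Function.Injective i) (e : B)
    (ψ : Cocycle A 1)
    (hψ : mapCochain i 1 ψ.1 = dCochain B 0 (orbitCochain hB e)) (r : A.ρ →ⁱL C'.ρ)
    (hC : ∀ g c, C'.ρ g c = c) (hr : mapH r 1 (cls A 1 ψ) = 0) (g : G) (a : A)
    (ha : i a = B.ρ g e - e) : r a = 0 := by
  rw [mapH_cls] at hr
  obtain ⟨y, hy⟩ := (cls_succ_eq_zero_iff _).mp hr
  have h1 : a = ((ψ.1.1 : C(G, C(G, A))) 1 : C(G, A)) g := by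
    apply hi
    have := DFunLike.congr_fun (DFunLike.congr_fun (congrArg Subtype.val hψ) (1 : G)) g
    change i (((ψ.1.1 : C(G, C(G, A))) 1 : C(G, A)) g) = B.ρ g e - B.ρ 1 e at this
    rw [this, ha, map_one]
    rfl
  have h2 := DFunLike.congr_fun (DFunLike.congr_fun (congrArg Subtype.val hy) (1 : G)) g
  change (y.1 : C(G, C')) g - (y.1 : C(G, C')) 1 =
    r (((ψ.1.1 : C(G, C(G, A))) 1 : C(G, A)) g) at h2
  -- An invariant `0`-cochain with values in a trivial module is constant, so its coboundary is
  -- zero.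
  have h3 := DFunLike.congr_fun (y.2 g) g
  change C'.ρ g ((y.1 : C(G, C')) (g⁻¹ * g)) = (y.1 : C(G, C')) g at h3
  rw [hC, inv_mul_cancel] at h3
  rw [h1, ← h2, h3, sub_self]

end ConnCup

end ContCoh

/-! ### Smooth `κ[G]`-modules, with cohomology over one base `k` for both `κ = 𝔽_p` and `κ = k`. -/

namespace ContCoh

open TopRep ContRepresentation MonoidAlgebra

section Smooth

variable (κ : Type w) [CommRing κ] (G : Type u) [Group G]

/-- The stabilizer of an element of a `κ[G]`-module. -/
def stab {M : Type*} [AddCommGroup M] [Module (MonoidAlgebra κ G) M] (m : M) : Subgroup G where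
  carrier := {g | MonoidAlgebra.of κ G g • m = m}
  mul_mem' {a b} ha hb := by
    change _ • _ = _ at ha hb ⊢
    rw [map_mul, mul_smul, hb, ha]
  one_mem' := by
    change _ • _ = _
    rw [map_one, one_smul]
  inv_mem' {a} ha := by
    change _ • _ = _ at ha ⊢
    nth_rw 1 [← ha]
    rw [← mul_smul, ← map_mul, inv_mul_cancel, map_one, one_smul]

lemma mem_stab {M : Type*} [AddCommGroup M] [Module (MonoidAlgebra κ G) M] {m : M} {g : G} :
    g ∈ stab κ G m ↔ MonoidAlgebra.of κ G g • m = m := Iff.rfl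

variable {G}

variable [TopologicalSpace G]

variable (G) in
/-- A `κ[G]`-module is smooth if the stabilizers of its elements are open. -/
class IsSmooth (M : Type*) [AddCommGroup M] [Module (MonoidAlgebra κ G) M] : Prop where
  isOpen_stab : ∀ m : M, IsOpen (stab κ G m : Set G)

variable {M N P : Type u} [AddCommGroup M] [Module (MonoidAlgebra κ G) M]
  [AddCommGroup N] [Module (MonoidAlgebra κ G) N]
  [AddCommGroup P] [Module (MonoidAlgebra κ G) P]

instance (S : Submodule (MonoidAlgebra κ G) M) [IsSmooth κ G M] : IsSmooth κ G S where
  isOpen_stab m := by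
    convert IsSmooth.isOpen_stab (κ := κ) (G := G) m.1 using 1
    ext g
    exact Subtype.ext_iff

variable [IsTopologicalGroup G]

instance (S : Submodule (MonoidAlgebra κ G) M) [IsSmooth κ G M] : IsSmooth κ G (M ⧸ S) where
  isOpen_stab m := by
    obtain ⟨m, rfl⟩ := S.mkQ_surjective m
    refine Subgroup.isOpen_mono (H₁ := stab κ G m) (fun g hg => ?_) (IsSmooth.isOpen_stab m)
    rw [mem_stab] at hg ⊢
    rw [← map_smul, hg]

lemma continuous_of_smul [IsSmooth κ G M] [TopologicalSpace M] [DiscreteTopology M] :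
    Continuous fun x : G × M => MonoidAlgebra.of κ G x.1 • x.2 := by
  rw [continuous_prod_of_discrete_right]
  intro m
  refine IsLocallyConstant.continuous ((IsLocallyConstant.iff_exists_open _).mpr fun x =>
    ⟨(fun g => x⁻¹ * g) ⁻¹' (stab κ G m : Set G),
      (IsSmooth.isOpen_stab m).preimage (continuous_const_mul _), ?_, fun g hg => ?_⟩)
  · simp [one_mem]
  · have h : MonoidAlgebra.of κ G (x⁻¹ * g) • m = m := hg
    change MonoidAlgebra.of κ G g • m = MonoidAlgebra.of κ G x • m
    conv_rhs => rw [← h, ← mul_smul, ← map_mul, mul_inv_cancel_left]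

variable (k : Type v) [CommRing k] [TopologicalSpace k] [Algebra k κ]
  [Module κ M] [IsScalarTower κ (MonoidAlgebra κ G) M]
  [Module κ N] [IsScalarTower κ (MonoidAlgebra κ G) N]
  [Module κ P] [IsScalarTower κ (MonoidAlgebra κ G) P]

variable (M) in
/-- The topological representation on the discrete topological module `M`. -/
noncomputable def toRep [DiscreteTopology k] : TopRep.{u} k G :=
  letI : TopologicalSpace M := ⊥
  haveI : DiscreteTopology M := ⟨rfl⟩
  letI : Module k M := Module.compHom M (algebraMap k κ)
  haveI : ContinuousSMul k M := ⟨continuous_of_discreteTopology⟩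
  TopRep.of (X := M) ⟨
    { toFun g :=
        { toFun m := MonoidAlgebra.of κ G g • m
          map_add' _ _ := smul_add _ _ _
          map_smul' c m := smul_comm (MonoidAlgebra.of κ G g) (algebraMap k κ c) m
          cont := continuous_of_discreteTopology }
      map_one' := ContinuousLinearMap.ext fun m => by
        change MonoidAlgebra.of κ G 1 • m = m
        rw [map_one, one_smul]
      map_mul' g h := ContinuousLinearMap.ext fun m => by
        change MonoidAlgebra.of κ G (g * h) • m =
          MonoidAlgebra.of κ G g • MonoidAlgebra.of κ G h • m
        rw [map_mul, mul_smul] }⟩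

variable [DiscreteTopology k]

lemma isDiscreteRep_toRep [IsSmooth κ G M] : IsDiscreteRep (toRep κ M k (G := G)) := by
  let _ : TopologicalSpace M := ⊥
  have h : DiscreteTopology M := ⟨rfl⟩
  have hc := continuous_of_smul κ (M := M) (G := G)
  exact ⟨h, hc⟩

variable {κ}

/-- The intertwining map induced by a `κ[G]`-linear map. -/
noncomputable def repMap (f : M →ₗ[MonoidAlgebra κ G] N) :
    (toRep κ M k (G := G)).ρ →ⁱL (toRep κ N k).ρ :=
  letI : TopologicalSpace M := ⊥
  haveI : DiscreteTopology M := ⟨rfl⟩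
  letI : TopologicalSpace N := ⊥
  haveI : DiscreteTopology N := ⟨rfl⟩
  letI : Module k M := Module.compHom M (algebraMap k κ)
  letI : Module k N := Module.compHom N (algebraMap k κ)
  { toFun := f
    map_add' := f.map_add
    map_smul' := fun c m => (f.restrictScalars κ).map_smul (algebraMap k κ c) m
    cont := continuous_bot
    isIntertwining' := fun _ => ContinuousLinearMap.ext fun m => f.map_smul _ m }

lemma isSES_repMap [IsSmooth κ G M] [IsSmooth κ G N] [IsSmooth κ G P]
    {f : M →ₗ[MonoidAlgebra κ G] N} {g : N →ₗ[MonoidAlgebra κ G] P} (hf : Function.Injective f)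
    (h : Function.Exact f g) (hg : Function.Surjective g) : IsSES (repMap k f) (repMap k g) :=
  ⟨isDiscreteRep_toRep κ k, isDiscreteRep_toRep κ k, isDiscreteRep_toRep κ k, hf, h, hg⟩

variable (κ M G) in
/-- The cohomology of a `κ[G]`-module. -/
noncomputable abbrev HM (n : ℕ) := H (toRep κ M k (G := G)) n

/-- The map on cohomology induced by a `κ[G]`-linear map. -/
noncomputable def mapM (f : M →ₗ[MonoidAlgebra κ G] N) (n : ℕ) :
    HM κ G M k n →ₗ[k] HM κ G N k n := mapH (repMap k f) n

lemma mapM_id (n : ℕ) (x : HM κ G M k n) :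
    mapM k (LinearMap.id : M →ₗ[MonoidAlgebra κ G] M) n x = x := mapH_id n x

lemma mapM_comp (g : N →ₗ[MonoidAlgebra κ G] P) (f : M →ₗ[MonoidAlgebra κ G] N) (n : ℕ)
    (x : HM κ G M k n) : mapM k (g ∘ₗ f) n x = mapM k g n (mapM k f n x) :=
  mapH_comp (repMap k g) (repMap k f) n x

lemma mapM_sub (f g : M →ₗ[MonoidAlgebra κ G] N) (n : ℕ) (x : HM κ G M k n) :
    mapM k (f - g) n x = mapM k f n x - mapM k g n x :=
  mapH_sub (repMap k f) (repMap k g) n x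

lemma mapM_zero (n : ℕ) (x : HM κ G M k n) :
    mapM k (0 : M →ₗ[MonoidAlgebra κ G] N) n x = 0 :=
  mapH_zero n x

lemma eq_zero_of_subsingleton [Subsingleton M] (n : ℕ) (x : HM κ G M k n) : x = 0 := by
  rw [← mapM_id k n x, show (LinearMap.id : M →ₗ[MonoidAlgebra κ G] M) = 0 from
    Subsingleton.elim _ _, mapM_zero]

end Smooth

section FixedPoints

variable {κ : Type w} [CommRing κ] {G : Type u} [Group G]
  {M : Type u} [AddCommGroup M] [Module (MonoidAlgebra κ G) M]

variable (κ G M) in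
/-- The action of `G` on a `κ[G]`-module by permutations. -/
noncomputable def permHom : G →* Equiv.Perm M :=
  letI := MulAction.compHom M (MonoidAlgebra.of κ G)
  MulAction.toPermHom G M

variable [TopologicalSpace G]

lemma isOpen_ker_permHom [Finite M] [IsSmooth κ G M] :
    IsOpen ((permHom κ G M).ker : Set G) := by
  have h : ((permHom κ G M).ker : Set G) = ⋂ m : M, (stab κ G m : Set G) := by
    ext g
    simp only [SetLike.mem_coe, MonoidHom.mem_ker, Equiv.ext_iff, Set.mem_iInter, mem_stab]
    rfl
  rw [h]
  exact isOpen_iInter_of_finite fun m => IsSmooth.isOpen_stab m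

/-- A finite smooth module of order divisible by `p` over a pro-`p` group has an invariant element
of order `p`. -/
lemma exists_fixed_addOrderOf_eq [IsTopologicalGroup G] {p : ℕ} [Fact p.Prime]
    (hG : IsProPGroup G p) [Finite M] [IsSmooth κ G M] (h : p ∣ Nat.card M) :
    ∃ m : M, addOrderOf m = p ∧ ∀ g : G, MonoidAlgebra.of κ G g • m = m := by
  -- The action on the finite `M` factors through a finite `p`-group, so the number of fixed points
  -- is congruent to the order of `M` modulo `p`.
  obtain ⟨r, hr⟩ := hG.index_eq_pow (permHom κ G M).ker inferInstance isOpen_ker_permHom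
  rw [Subgroup.index_ker] at hr
  have hP : IsPGroup p (permHom κ G M).range := IsPGroup.of_card hr
  let F : AddSubgroup M :=
    { carrier := {m | ∀ g : G, MonoidAlgebra.of κ G g • m = m}
      add_mem' := fun {a b} ha hb g => by rw [smul_add, ha g, hb g]
      zero_mem' := fun g => smul_zero _
      neg_mem' := fun {a} ha g => by rw [smul_neg, ha g] }
  have hF : (F : Set M) = MulAction.fixedPoints (permHom κ G M).range M := by
    ext m
    refine ⟨fun hm => ?_, fun hm g => hm ⟨permHom κ G M g, g, rfl⟩⟩
    rintro ⟨_, g, rfl⟩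
    exact hm g
  have hc : p ∣ Nat.card F := by
    have h1 := (hP.card_modEq_card_fixedPoints M).symm.trans h.modEq_zero_nat
    rw [← hF] at h1
    exact Nat.modEq_zero_iff_dvd.mp h1
  obtain ⟨x, hx⟩ := exists_prime_addOrderOf_dvd_card' p hc
  exact ⟨x, by rw [AddSubgroup.addOrderOf_coe, hx], x.2⟩

end FixedPoints

end ContCoh

/-! ### Finite groups of functionals. -/

/-- A finite-dimensional subspace of a dual space is its own double annihilator, even if `E` is
infinite-dimensional. -/
lemma Submodule.mem_of_forall_eq_zero {𝕜 E : Type*} [Field 𝕜] [AddCommGroup E] [Module 𝕜 E]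
    (S : Submodule 𝕜 (Module.Dual 𝕜 E)) [Finite S] (φ : Module.Dual 𝕜 E)
    (h : ∀ y, (∀ s ∈ S, s y = 0) → φ y = 0) : φ ∈ S := by
  have h1 := mem_span_of_iInf_ker_le_ker (L := fun s : S => s.1) (K := φ) fun y hy =>
    h y fun s hs => by
      rw [Submodule.mem_iInf] at hy
      exact hy ⟨s, hs⟩
  rwa [Subtype.range_val_subtype, show {x | x ∈ S} = (S : Set (Module.Dual 𝕜 E)) from rfl,
    Submodule.span_eq] at h1

/-- Additive maps between `𝔽_p`-vector spaces are linear. The additive form suits cohomology groups,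
which are only `k`-modules a priori. -/
lemma AddMonoidHom.mem_of_forall_eq_zero {p : ℕ} [Fact p.Prime] {Y : Type*} [AddCommGroup Y]
    [Module (ZMod p) Y] (S : AddSubgroup (Y →+ ZMod p)) [Finite S] (φ : Y →+ ZMod p)
    (h : ∀ y, (∀ s ∈ S, s y = 0) → φ y = 0) : φ ∈ S := by
  let S' : Submodule (ZMod p) (Module.Dual (ZMod p) Y) :=
    { carrier := {f | f.toAddMonoidHom ∈ S}
      add_mem' := fun hf hg => S.add_mem hf hg
      zero_mem' := S.zero_mem
      smul_mem' := fun c f hf => by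
        change LinearMap.toAddMonoidHom (c • f) ∈ S
        convert S.nsmul_mem hf c.val using 1
        ext y
        simp }
  have : Finite S' := Finite.of_injective (fun f : S' => (⟨f.1.toAddMonoidHom, f.2⟩ : S))
    fun f g hfg => Subtype.ext (LinearMap.toAddMonoidHom_injective (congrArg Subtype.val hfg))
  exact Submodule.mem_of_forall_eq_zero S' (φ.toZModLinearMap p) fun y hy =>
    h y fun s hs => hy (s.toZModLinearMap p) hs

/-! ### The trivial module `𝔽_p`, and maps to and from it. -/

namespace ContCoh

open TopRep ContRepresentation MonoidAlgebra

section NSMul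

variable {κ : Type w} [CommRing κ] {G : Type u} [Group G] [TopologicalSpace G]
  [IsTopologicalGroup G] {M N : Type u} [AddCommGroup M] [Module (MonoidAlgebra κ G) M]
  [AddCommGroup N] [Module (MonoidAlgebra κ G) N]
  (k : Type v) [CommRing k] [TopologicalSpace k] [DiscreteTopology k] [Algebra k κ]
  [Module κ M] [IsScalarTower κ (MonoidAlgebra κ G) M]
  [Module κ N] [IsScalarTower κ (MonoidAlgebra κ G) N]

/-- `mapM` as an additive map in the homomorphism. -/
noncomputable def mapMHom (n : ℕ) (x : HM κ G M k n) :
    (M →ₗ[MonoidAlgebra κ G] N) →+ HM κ G N k n :=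
  AddMonoidHom.ofMapSub (fun f => mapM k f n x) fun f g => mapM_sub k f g n x

lemma mapMHom_apply (n : ℕ) (x : HM κ G M k n) (f : M →ₗ[MonoidAlgebra κ G] N) :
    mapMHom k n x f = mapM k f n x := rfl

lemma nsmul_eq_zero_of_forall {m : ℕ} (hm : ∀ a : M, m • a = 0) (n : ℕ) (x : HM κ G M k n) :
    m • x = 0 := by
  have h : m • (LinearMap.id : M →ₗ[MonoidAlgebra κ G] M) = 0 := LinearMap.ext hm
  rw [← mapM_id k n x, ← mapMHom_apply, ← map_nsmul, h, map_zero]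

end NSMul

section Fp

variable (p : ℕ) [Fact p.Prime] (G : Type u) [Group G]

/-- The field `𝔽_p`, as a trivial `𝔽_p[G]`-module. -/
def Fp : Type u := ULift.{u} (ZMod p)

noncomputable instance : AddCommGroup (Fp.{u} p) := inferInstanceAs (AddCommGroup (ULift (ZMod p)))
noncomputable instance : Module (ZMod p) (Fp.{u} p) :=
  inferInstanceAs (Module (ZMod p) (ULift (ZMod p)))
instance : Finite (Fp.{u} p) := inferInstanceAs (Finite (ULift (ZMod p)))

noncomputable instance : Module (MonoidAlgebra (ZMod p) G) (Fp.{u} p) :=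
  Module.compHom _ (MonoidAlgebra.lift (ZMod p) (ZMod p) G 1).toRingHom

variable {G} in
@[simp] lemma of_smul_Fp (g : G) (t : Fp.{u} p) : MonoidAlgebra.of (ZMod p) G g • t = t := by
  change MonoidAlgebra.lift (ZMod p) (ZMod p) G 1 (MonoidAlgebra.of (ZMod p) G g) • t = t
  rw [MonoidAlgebra.lift_of, MonoidHom.one_apply, one_smul]

instance : IsScalarTower (ZMod p) (MonoidAlgebra (ZMod p) G) (Fp.{u} p) where
  smul_assoc c x t := by
    change MonoidAlgebra.lift (ZMod p) (ZMod p) G 1 (c • x) • t =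
      c • MonoidAlgebra.lift (ZMod p) (ZMod p) G 1 x • t
    rw [map_smul, smul_assoc]

instance [TopologicalSpace G] : IsSmooth (ZMod p) G (Fp.{u} p) where
  isOpen_stab m := by
    convert isOpen_univ
    exact Set.eq_univ_of_forall fun g => of_smul_Fp p g m

/-- The generator `1` of `𝔽_p`. -/
def Fp.one : Fp.{u} p := ULift.up (1 : ZMod p)

variable {p G}

lemma Fp.down_smul_one (t : Fp.{u} p) : t.down • Fp.one p = t :=
  ULift.ext _ _ (mul_one (M := ZMod p) t.down)

lemma Fp.one_ne_zero : Fp.one.{u} p ≠ 0 := fun h =>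
  _root_.one_ne_zero (α := ZMod p) (congrArg ULift.down h)

variable {M : Type u} [AddCommGroup M] [Module (ZMod p) M] [Module (MonoidAlgebra (ZMod p) G) M]
  [IsScalarTower (ZMod p) (MonoidAlgebra (ZMod p) G) M]
  {N : Type u} [AddCommGroup N] [Module (ZMod p) N] [Module (MonoidAlgebra (ZMod p) G) N]
  [IsScalarTower (ZMod p) (MonoidAlgebra (ZMod p) G) N]

/-- An additive equivariant map of `𝔽_p[G]`-modules is linear. -/
noncomputable def equivariantHom (f : M →+ N)
    (h : ∀ (g : G) m, f (MonoidAlgebra.of (ZMod p) G g • m) = MonoidAlgebra.of (ZMod p) G g • f m) :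
    M →ₗ[MonoidAlgebra (ZMod p) G] N :=
  MonoidAlgebra.equivariantOfLinearOfComm (f.toZModLinearMap p) h

lemma map_down_smul (f : M →ₗ[MonoidAlgebra (ZMod p) G] N) (c : ZMod p) (m : M) :
    f (c • m) = c • f m := (f.restrictScalars (ZMod p)).map_smul c m

lemma p_nsmul_eq_zero (m : M) : p • m = 0 := by
  rw [← Nat.cast_smul_eq_nsmul (ZMod p), CharP.cast_eq_zero, zero_smul]

/-- The map `𝔽_p → M`, `1 ↦ m`, for invariant `m`. -/
noncomputable def ofFixed (m : M) (hm : ∀ g : G, MonoidAlgebra.of (ZMod p) G g • m = m) :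
    Fp.{u} p →ₗ[MonoidAlgebra (ZMod p) G] M :=
  equivariantHom
    (AddMonoidHom.mk' (fun t : Fp p => t.down • m) fun s t => add_smul s.down t.down m)
    fun g t => by
      rw [of_smul_Fp]
      change t.down • m = MonoidAlgebra.of (ZMod p) G g • t.down • m
      rw [smul_comm, hm]

lemma ofFixed_apply (m : M) (hm) (t : Fp.{u} p) : ofFixed (G := G) m hm t = t.down • m := rfl

lemma Fp.injective_of_ne_zero {i : Fp.{u} p →ₗ[MonoidAlgebra (ZMod p) G] M} (hi : i ≠ 0) :
    Function.Injective i := by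
  rw [injective_iff_map_eq_zero]
  intro t ht
  by_contra h
  have hd : t.down ≠ 0 := fun h' => h (ULift.ext _ _ h')
  apply hi
  ext s
  have : s = (s.down * t.down⁻¹) • t := ULift.ext _ _ (by
    change s.down = s.down * t.down⁻¹ * t.down
    rw [mul_assoc, inv_mul_cancel₀ hd, mul_one])
  rw [this, map_down_smul, ht, smul_zero, LinearMap.zero_apply]

lemma Fp.surjective_of_ne_zero {f : M →ₗ[MonoidAlgebra (ZMod p) G] Fp.{u} p} (hf : f ≠ 0) :
    Function.Surjective f := by
  intro s
  obtain ⟨m, hm⟩ : ∃ m, f m ≠ 0 := by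
    by_contra! h
    exact hf (LinearMap.ext h)
  have hd : (f m).down ≠ 0 := fun h' => hm (ULift.ext _ _ h')
  refine ⟨(s.down * (f m).down⁻¹) • m, ?_⟩
  rw [map_down_smul]
  refine ULift.ext _ _ ?_
  change s.down * (f m).down⁻¹ * (f m).down = s.down
  rw [mul_assoc, inv_mul_cancel₀ hd, mul_one]

/-- A map `r : ker ρ → 𝔽_p` vanishing on all `g e - e`, where `ρ e = 1`, extends. -/
lemma exists_extension (ρ : M →ₗ[MonoidAlgebra (ZMod p) G] Fp.{u} p) (e : M)
    (he : ρ e = Fp.one p) (r : LinearMap.ker ρ →ₗ[MonoidAlgebra (ZMod p) G] Fp.{u} p)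
    (hr : ∀ (g : G) (m : LinearMap.ker ρ), m.1 = MonoidAlgebra.of (ZMod p) G g • e - e → r m = 0) :
    ∃ r' : M →ₗ[MonoidAlgebra (ZMod p) G] Fp.{u} p, r' ∘ₗ (LinearMap.ker ρ).subtype = r := by
  have hmem : ∀ m, m - (ρ m).down • e ∈ LinearMap.ker ρ := fun m => by
    rw [LinearMap.mem_ker, map_sub, map_down_smul, he, Fp.down_smul_one, sub_self]
  -- The projection onto `ker ρ` along `e` fails to be equivariant only by multiples of `g e - e`,
  -- and these are killed by `r`.
  let c : M → LinearMap.ker ρ := fun m => ⟨m - (ρ m).down • e, hmem m⟩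
  have hadd : ∀ a b, c (a + b) = c a + c b := fun a b => Subtype.ext (by
    change a + b - (ρ (a + b)).down • e = (a - (ρ a).down • e) + (b - (ρ b).down • e)
    rw [map_add, show (ρ a + ρ b).down = (ρ a).down + (ρ b).down from rfl, add_smul]
    abel)
  refine ⟨equivariantHom (AddMonoidHom.mk' (fun m => r (c m)) fun a b => by
    rw [hadd, map_add]) fun g m => ?_, ?_⟩
  · have hg : MonoidAlgebra.of (ZMod p) G g • e - e ∈ LinearMap.ker ρ := by
      rw [LinearMap.mem_ker, map_sub, map_smul, of_smul_Fp, sub_self]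
    have h1 : c (MonoidAlgebra.of (ZMod p) G g • m) = MonoidAlgebra.of (ZMod p) G g • c m +
        (ρ m).down • ⟨_, hg⟩ := Subtype.ext (by
      change MonoidAlgebra.of (ZMod p) G g • m - (ρ (MonoidAlgebra.of (ZMod p) G g • m)).down • e =
        MonoidAlgebra.of (ZMod p) G g • (m - (ρ m).down • e) +
          (ρ m).down • (MonoidAlgebra.of (ZMod p) G g • e - e)
      rw [map_smul, of_smul_Fp, smul_sub, smul_sub, smul_comm]
      abel)
    change r (c _) = MonoidAlgebra.of (ZMod p) G g • r (c m)
    rw [h1, map_add, map_smul, map_down_smul, hr g ⟨_, hg⟩ rfl, smul_zero, add_zero]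
  · ext m
    change r (c m.1) = r m
    congr 1
    refine Subtype.ext ?_
    change m.1 - (ρ m.1).down • e = m.1
    rw [LinearMap.mem_ker.mp m.2]
    exact (congrArg _ (zero_smul _ e)).trans (sub_zero _)

variable [TopologicalSpace G] [IsTopologicalGroup G]

lemma exists_ofFixed_injective (hG : IsProPGroup G p) [Finite M] [Nontrivial M]
    [IsSmooth (ZMod p) G M] :
    ∃ i : Fp.{u} p →ₗ[MonoidAlgebra (ZMod p) G] M, Function.Injective i := by
  obtain ⟨m, hm⟩ := exists_ne (0 : M)
  have h : p ∣ Nat.card M := by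
    rw [← addOrderOf_eq_prime (p_nsmul_eq_zero (p := p) m) hm]
    exact addOrderOf_dvd_natCard m
  obtain ⟨m, hp, hf⟩ := exists_fixed_addOrderOf_eq (κ := ZMod p) hG h
  refine ⟨ofFixed m hf, Fp.injective_of_ne_zero fun h0 => ?_⟩
  have h1 := LinearMap.congr_fun h0 (Fp.one p)
  rw [ofFixed_apply] at h1
  change (1 : ZMod p) • m = 0 at h1
  rw [one_smul] at h1
  rw [h1, addOrderOf_zero] at hp
  exact (Fact.out : p.Prime).one_lt.ne hp

/-- A simple quotient of `M` contains a trivial line by `exists_ofFixed_injective`, hence equals it.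
-/
lemma exists_hom_Fp_ne_zero (hG : IsProPGroup G p) [Finite M] [Nontrivial M]
    [IsSmooth (ZMod p) G M] : ∃ f : M →ₗ[MonoidAlgebra (ZMod p) G] Fp.{u} p, f ≠ 0 := by
  obtain ⟨S, hS, -⟩ := (eq_top_or_exists_le_coatom (⊥ : Submodule (MonoidAlgebra (ZMod p) G) M)
    ).resolve_left bot_ne_top
  have hs : IsSimpleModule (MonoidAlgebra (ZMod p) G) (M ⧸ S) := isSimpleModule_iff_isCoatom.mpr hS
  have := hs.nontrivial
  have := Finite.of_surjective _ S.mkQ_surjective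
  obtain ⟨i, hi⟩ := exists_ofFixed_injective (M := M ⧸ S) hG
  have hr : LinearMap.range i = ⊤ := (eq_bot_or_eq_top _).resolve_left fun h => by
    have : i (Fp.one p) = 0 := by
      rw [← Submodule.mem_bot (R := MonoidAlgebra (ZMod p) G), ← h]
      exact ⟨_, rfl⟩
    exact Fp.one_ne_zero (hi (this.trans (map_zero i).symm))
  let e := LinearEquiv.ofBijective i ⟨hi, LinearMap.range_eq_top.mp hr⟩
  refine ⟨e.symm.toLinearMap ∘ₗ S.mkQ, fun h => ?_⟩
  obtain ⟨m, hm⟩ := S.mkQ_surjective (e (Fp.one p))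
  have h1 := LinearMap.congr_fun h m
  rw [LinearMap.comp_apply, hm] at h1
  exact Fp.one_ne_zero ((e.symm_apply_apply _).symm.trans h1)

end Fp

end ContCoh

/-! ### Duality in the top degree for finite `𝔽_p[G]`-modules. -/

lemma ZMod.exists_nsmul_eq {p : ℕ} [Fact p.Prime] {Y : Type*} [AddCommGroup Y] (e : Y ≃+ ZMod p)
    {s : Y} (hs : s ≠ 0) (t : Y) : ∃ m : ℕ, m • s = t := by
  have h : e s ≠ 0 := fun h => hs (e.injective (h.trans (map_zero e).symm))
  refine ⟨(e t * (e s)⁻¹).val, e.injective ?_⟩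
  rw [map_nsmul, nsmul_eq_mul, ZMod.natCast_zmod_val, mul_assoc, inv_mul_cancel₀ h, mul_one]

lemma Submodule.natCard_quotient_lt {R M : Type*} [Ring R] [AddCommGroup M] [Module R M] [Finite M]
    {S : Submodule R M} (h : S ≠ ⊥) : Nat.card (M ⧸ S) < Nat.card M := by
  refine (Nat.card_le_card_of_surjective _ S.mkQ_surjective).lt_of_ne fun hc => h ?_
  rw [← S.ker_mkQ, LinearMap.ker_eq_bot.mpr
    ((Nat.bijective_iff_surjective_and_card _).mpr ⟨S.mkQ_surjective, hc.symm⟩).1]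

lemma Submodule.natCard_lt {R M : Type*} [Ring R] [AddCommGroup M] [Module R M] [Finite M]
    {S : Submodule R M} (h : S ≠ ⊤) : Nat.card S < Nat.card M := by
  obtain ⟨m, hm⟩ : ∃ m, m ∉ S := by
    by_contra! h'
    exact h (Submodule.eq_top_iff'.mpr h')
  exact Finite.card_subtype_lt hm

namespace ContCoh

open TopRep ContRepresentation MonoidAlgebra

variable {p : ℕ} [Fact p.Prime] {G : Type u} [Group G] [TopologicalSpace G] [IsTopologicalGroup G]
  (k : Type v) [CommRing k] [TopologicalSpace k] [DiscreteTopology k] [Algebra k (ZMod p)]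

section Pairing

variable (M : Type u) [AddCommGroup M] [Module (ZMod p) M] [Module (MonoidAlgebra (ZMod p) G) M]
  [IsScalarTower (ZMod p) (MonoidAlgebra (ZMod p) G) M]
  {N : Type u} [AddCommGroup N] [Module (ZMod p) N] [Module (MonoidAlgebra (ZMod p) G) N]
  [IsScalarTower (ZMod p) (MonoidAlgebra (ZMod p) G) N]

omit [TopologicalSpace G] [IsTopologicalGroup G] in
lemma down_smul_of_smul (g : G) (m : M) (t : Fp.{u} p) :
    (MonoidAlgebra.of (ZMod p) G g • t).down • (MonoidAlgebra.of (ZMod p) G g • m) =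
      MonoidAlgebra.of (ZMod p) G g • t.down • m := by
  rw [of_smul_Fp, smul_comm]

omit [TopologicalSpace G] [IsTopologicalGroup G] in
lemma map_down_smul_of_smul (ρ : M →ₗ[MonoidAlgebra (ZMod p) G] Fp.{u} p) (e : M)
    (he : ρ e = Fp.one p) (g : G) (t : Fp.{u} p) :
    ρ (t.down • MonoidAlgebra.of (ZMod p) G g • e) = t := by
  rw [map_down_smul, map_smul, of_smul_Fp, he, Fp.down_smul_one]

/-- The pairing `M × 𝔽_p → M` given by scalar multiplication. -/
noncomputable def smulPairing : GPairing (toRep (ZMod p) M k (G := G))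
    (toRep (ZMod p) (Fp.{u} p) k) (toRep (ZMod p) M k) where
  toLin := LinearMap.mk₂ k (fun (m : M) (t : Fp.{u} p) => (t.down • m : M))
    (fun a b t => smul_add (A := M) (ULift.down t) a b)
    (fun c a t => smul_comm (α := M) (ULift.down t) (algebraMap k (ZMod p) c) a)
    (fun a s t => add_smul (M := M) (ULift.down s) (ULift.down t) a)
    (fun c a t => mul_smul (β := M) (algebraMap k (ZMod p) c) (ULift.down t) a)
  continuous_toLin := by
    have h1 : DiscreteTopology (toRep (ZMod p) M k (G := G)) := ⟨rfl⟩
    have h2 : DiscreteTopology (toRep (ZMod p) (Fp.{u} p) k (G := G)) := ⟨rfl⟩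
    exact continuous_of_discreteTopology
  equivariant g a b := down_smul_of_smul M g a b

variable {M}

omit [TopologicalSpace G] [IsTopologicalGroup G] in
lemma smulPairing_repMap (f : M →ₗ[MonoidAlgebra (ZMod p) G] N) (a) (t) :
    (smulPairing k N).toLin (repMap k f a) t = repMap k f ((smulPairing k M).toLin a t) :=
  (map_down_smul f (t : Fp.{u} p).down a).symm

/-- The cup product `H¹(G, M) × H^d(G, 𝔽_p) → H^{d+1}(G, M)`. -/
noncomputable def cupFp (d : ℕ) (x : HM (ZMod p) G M k 1) :
    HM (ZMod p) G (Fp.{u} p) k d →ₗ[k] HM (ZMod p) G M k (d + 1) :=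
  cup (smulPairing k M) 1 d (d + 1) (by omega) x

lemma cupFp_add (d : ℕ) (x y : HM (ZMod p) G M k 1) :
    cupFp k d (x + y) = cupFp k d x + cupFp k d y :=
  map_add _ x y

lemma cupFp_mapM (f : M →ₗ[MonoidAlgebra (ZMod p) G] N) (d : ℕ) (x : HM (ZMod p) G M k 1)
    (y : HM (ZMod p) G (Fp.{u} p) k d) :
    cupFp k d (mapM k f 1 x) y = mapM k f (d + 1) (cupFp k d x y) := by
  have h := cup_mapH (smulPairing k M) (smulPairing k N) (repMap k f) ContIntertwiningMap.id
    (repMap k f) (smulPairing_repMap k f) 1 d (d + 1) (by omega) x y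
  rw [mapH_id] at h
  exact h

end Pairing

variable (p G) in
/-- The part of the duality used below: `H^{d+1}(G, 𝔽_p) ≅ 𝔽_p`, and no nonzero class in
`H¹(G, 𝔽_p)` is orthogonal to `H^d(G, 𝔽_p)`. -/
structure HasDuality (d : ℕ) : Prop where
  nonempty_addEquiv : Nonempty (HM (ZMod p) G (Fp.{u} p) k (d + 1) ≃+ ZMod p)
  eq_zero : ∀ x : HM (ZMod p) G (Fp.{u} p) k 1, (∀ y, cupFp k d x y = 0) → x = 0

variable {k} {d : ℕ}

section

variable {M : Type u} [AddCommGroup M] [Module (ZMod p) M] [Module (MonoidAlgebra (ZMod p) G) M]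
  [IsScalarTower (ZMod p) (MonoidAlgebra (ZMod p) G) M] [IsSmooth (ZMod p) G M] [Finite M]

-- The functionals `y ↦ f_* ξ ∪ y` with `f ∈ T` form a finite group. If every `y` killed by them
-- were killed by the functional of `r`, the latter would equal that of some `f ∈ T`; then `(r -
-- f)_* ξ` would be orthogonal to `H^d`, hence zero.
omit [IsSmooth (ZMod p) G M] in
lemma HasDuality.exists_cupFp (D : HasDuality p G k d)
    (ξ : HM (ZMod p) G M k 1) (r : M →ₗ[MonoidAlgebra (ZMod p) G] Fp.{u} p)
    (T : AddSubgroup (M →ₗ[MonoidAlgebra (ZMod p) G] Fp.{u} p))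
    (h : ∀ f ∈ T, mapM k (r - f) 1 ξ ≠ 0) :
    ∃ y, cupFp k d (mapM k r 1 ξ) y ≠ 0 ∧ ∀ f ∈ T, cupFp k d (mapM k f 1 ξ) y = 0 := by
  obtain ⟨ε⟩ := D.nonempty_addEquiv
  have : Finite (M →ₗ[MonoidAlgebra (ZMod p) G] Fp.{u} p) := DFunLike.finite _
  let _ : Module (ZMod p) (HM (ZMod p) G (Fp.{u} p) k d) :=
    AddCommGroup.zmodModule (nsmul_eq_zero_of_forall k p_nsmul_eq_zero d)
  let Φ : (M →ₗ[MonoidAlgebra (ZMod p) G] Fp.{u} p) →+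
      (HM (ZMod p) G (Fp.{u} p) k d →+ ZMod p) :=
    AddMonoidHom.mk' (fun f => ε.toAddMonoidHom.comp (cupFp k d (mapM k f 1 ξ)).toAddMonoidHom)
      fun f g => AddMonoidHom.ext fun y => by
        change ε (cupFp k d (mapM k (f + g) 1 ξ) y) = ε (cupFp k d (mapM k f 1 ξ) y) +
          ε (cupFp k d (mapM k g 1 ξ) y)
        rw [← mapMHom_apply, map_add, cupFp_add, LinearMap.add_apply, map_add]
        rfl
  have hΦ : ∀ f y, Φ f y = 0 ↔ cupFp k d (mapM k f 1 ξ) y = 0 := fun f y =>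
    map_eq_zero_iff ε ε.injective
  have hfin : Finite (T.map Φ) :=
    (Set.toFinite (T : Set (M →ₗ[MonoidAlgebra (ZMod p) G] Fp.{u} p))).image Φ
  by_contra! hc
  have hmem := AddMonoidHom.mem_of_forall_eq_zero (T.map Φ) (Φ r) fun y hy => by
    rw [hΦ]
    by_contra h1
    obtain ⟨f, hf, h2⟩ := hc y h1
    exact h2 ((hΦ f y).mp (hy _ ⟨f, hf, rfl⟩))
  obtain ⟨f, hf, hfr⟩ := hmem
  refine h f hf (D.eq_zero _ fun y => (hΦ _ y).mp ?_)
  rw [map_sub, hfr, sub_self, AddMonoidHom.zero_apply]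

omit [IsSmooth (ZMod p) G M] [Finite M] in
lemma eq_zero_of_mapM_comp_eq_zero {n : ℕ} (i : Fp.{u} p →ₗ[MonoidAlgebra (ZMod p) G] M)
    (r : M →ₗ[MonoidAlgebra (ZMod p) G] Fp.{u} p) (h : r ∘ₗ i ≠ 0)
    (t : HM (ZMod p) G (Fp.{u} p) k n) (ht : mapM k r n (mapM k i n t) = 0) : t = 0 := by
  let e := LinearEquiv.ofBijective (r ∘ₗ i)
    ⟨Fp.injective_of_ne_zero h, Fp.surjective_of_ne_zero h⟩
  have h1 : e.symm.toLinearMap ∘ₗ (r ∘ₗ i) = LinearMap.id :=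
    LinearMap.ext fun t => e.symm_apply_apply t
  rw [← mapM_id k n t, ← h1, mapM_comp, mapM_comp, ht, map_zero]

end

/-- The duality between `H^{d+1}(G, E)` and `Hom_G(E, 𝔽_p)`: the latter separates the elements of
the former. -/
theorem HasDuality.eq_zero_of_forall_hom (D : HasDuality p G k d) (hG : IsProPGroup G p) (m : ℕ) :
    ∀ (E : Type u) [AddCommGroup E] [Module (ZMod p) E] [Module (MonoidAlgebra (ZMod p) G) E]
      [IsScalarTower (ZMod p) (MonoidAlgebra (ZMod p) G) E] [IsSmooth (ZMod p) G E] [Finite E],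
      Nat.card E = m → ∀ x : HM (ZMod p) G E k (d + 1),
      (∀ f : E →ₗ[MonoidAlgebra (ZMod p) G] Fp.{u} p, mapM k f (d + 1) x = 0) → x = 0 := by
  induction m using Nat.strong_induction_on with
  | _ m ih =>
  intro E _ _ _ _ _ _ hE x hx
  have := hG.compactSpace
  rcases subsingleton_or_nontrivial E with hsub | hnt
  · exact eq_zero_of_subsingleton k _ x
  obtain ⟨i, hi⟩ := exists_ofFixed_injective (M := E) hG
  have hi0 : ∀ {S : Type u} [AddCommGroup S] [Module (MonoidAlgebra (ZMod p) G) S]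
      (j : Fp.{u} p →ₗ[MonoidAlgebra (ZMod p) G] S), Function.Injective j →
      LinearMap.range j ≠ ⊥ := fun j hj h => Fp.one_ne_zero (hj (by
    rw [map_zero, ← Submodule.mem_bot (R := MonoidAlgebra (ZMod p) G), ← h]
    exact ⟨_, rfl⟩))
  have hSES : ∀ {S : Type u} [AddCommGroup S] [Module (ZMod p) S]
      [Module (MonoidAlgebra (ZMod p) G) S]
      [IsScalarTower (ZMod p) (MonoidAlgebra (ZMod p) G) S] [IsSmooth (ZMod p) G S]
      (j : Fp.{u} p →ₗ[MonoidAlgebra (ZMod p) G] S), Function.Injective j →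
      IsSES (repMap k j) (repMap k (LinearMap.range j).mkQ) := fun j hj =>
    isSES_repMap k hj (LinearMap.exact_map_mkQ_range j) (Submodule.mkQ_surjective _)
  have hfin : Finite (E ⧸ LinearMap.range i) := Finite.of_surjective _ (Submodule.mkQ_surjective _)
  have hq : mapM k (LinearMap.range i).mkQ (d + 1) x = 0 :=
    ih _ (hE ▸ Submodule.natCard_quotient_lt (hi0 i hi)) _ rfl _ fun f => by
      rw [← mapM_comp, hx]
  obtain ⟨t, rfl⟩ := (hSES i hi).exact_mid x hq
  change mapM k i (d + 1) t = 0
  -- If some functional is nonzero on the line `i`, it restricts to an isomorphism there and detects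
  -- `t`.
  by_cases hs : ∃ r : E →ₗ[MonoidAlgebra (ZMod p) G] Fp.{u} p, r ∘ₗ i ≠ 0
  · obtain ⟨r, hr⟩ := hs
    rw [eq_zero_of_mapM_comp_eq_zero i r hr t (hx r), map_zero]
  push Not at hs
  obtain ⟨ρ, hρ⟩ := exists_hom_Fp_ne_zero (M := E) hG
  have hρs := Fp.surjective_of_ne_zero hρ
  obtain ⟨e, he⟩ := hρs (Fp.one p)
  let i' : Fp.{u} p →ₗ[MonoidAlgebra (ZMod p) G] LinearMap.ker ρ :=
    i.codRestrict _ fun t => LinearMap.congr_fun (hs ρ) t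
  have hi' : Function.Injective i' := fun a b h => hi (congrArg Subtype.val h)
  have hcard : Nat.card (LinearMap.ker ρ) < m := hE ▸ Submodule.natCard_lt fun h =>
    hρ (LinearMap.ker_eq_top.mp h)
  have hii : (LinearMap.ker ρ).subtype ∘ₗ i' = i := rfl
  -- The line now lies in `ker ρ`. If no functional on `ker ρ` detects it, the induction hypothesis
  -- kills `t` already in `H^{d+1}(G, ker ρ)`.
  by_cases hr : ∀ r : LinearMap.ker ρ →ₗ[MonoidAlgebra (ZMod p) G] Fp.{u} p, r ∘ₗ i' = 0
  · rw [← hii, mapM_comp, ih _ hcard _ rfl (mapM k i' (d + 1) t) fun f => by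
      rw [← mapM_comp, hr, mapM_zero], map_zero]
  push Not at hr
  obtain ⟨r, hr⟩ := hr
  have S : IsSES (repMap k (LinearMap.ker ρ).subtype) (repMap k ρ) :=
    isSES_repMap k (Submodule.subtype_injective _) (LinearMap.exact_subtype_ker_map ρ) hρs
  obtain ⟨ψ, hψ⟩ := S.exists_cocycle (e : E) fun g => by
    exact of_smul_Fp p g (ρ e)
  let T : AddSubgroup (LinearMap.ker ρ →ₗ[MonoidAlgebra (ZMod p) G] Fp.{u} p) :=
    { carrier := {f | f ∘ₗ i' = 0}
      add_mem' := fun {f g} hf hg => by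
        change (f + g) ∘ₗ i' = 0
        rw [LinearMap.add_comp, show f ∘ₗ i' = 0 from hf, show g ∘ₗ i' = 0 from hg, add_zero]
      zero_mem' := LinearMap.zero_comp _
      neg_mem' := fun {f} hf => by
        change (-f) ∘ₗ i' = 0
        rw [LinearMap.neg_comp, show f ∘ₗ i' = 0 from hf, neg_zero] }
  -- If `(r - f)_* ξ` vanished, `r - f` would kill all `g e - e` and so extend to a functional on
  -- `E`. Its value on the line would be that of `r`, which is nonzero, whereas functionals on `E`
  -- kill the line.
  obtain ⟨y, hy, hyT⟩ := D.exists_cupFp (cls _ 1 ψ) r T fun f hf h0 => by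
    obtain ⟨r', hr'⟩ := exists_extension ρ e he (r - f) fun g a ha =>
      eq_zero_of_mapH_cls_eq_zero S.discrete_mid S.injective (e : E) ψ hψ (repMap k (r - f))
        (fun g c => of_smul_Fp p g c) h0 g a ha
    have h1 := hs r'
    rw [← hii, ← LinearMap.comp_assoc, hr', LinearMap.sub_comp, show f ∘ₗ i' = 0 from hf,
      sub_zero] at h1
    exact hr h1
  set a := cupFp k d (cls _ 1 ψ) y with ha
  have hconn : Conn (repMap k (LinearMap.ker ρ).subtype) (repMap k ρ) d y a :=
    conn_cup (i := repMap k (LinearMap.ker ρ).subtype) (q := repMap k ρ) S.discrete_mid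
      (e : E) (smulPairing k _) (smulPairing k E)
      (smulPairing_repMap k _) (map_down_smul_of_smul E ρ e he) ψ hψ d y
  have hfin' : Finite (LinearMap.ker ρ ⧸ LinearMap.range i') :=
    Finite.of_surjective _ (Submodule.mkQ_surjective _)
  -- Functionals on `ker ρ` modulo the line are exactly the members of `T`, which kill `a = ξ ∪ y`.
  -- By induction `a` comes from the line.
  have hja : mapM k (LinearMap.range i').mkQ (d + 1) a = 0 :=
    ih _ ((Submodule.natCard_quotient_lt (hi0 i' hi')).trans hcard) _ rfl _ fun f => by
      rw [← mapM_comp, ha, ← cupFp_mapM]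
      refine hyT _ ?_
      change (f ∘ₗ (LinearMap.range i').mkQ) ∘ₗ i' = 0
      rw [LinearMap.comp_assoc, LinearMap.range_mkQ_comp, LinearMap.comp_zero]
  obtain ⟨t', ht'⟩ := (hSES i' hi').exact_mid a hja
  change mapM k i' (d + 1) t' = a at ht'
  have ht0 : t' ≠ 0 := by
    rintro rfl
    rw [cupFp_mapM, ← ha, ← ht', map_zero, map_zero] at hy
    exact hy rfl
  -- The class `a` is the image of `y` under the connecting map, so it dies in `E`.
  have hit : mapM k i (d + 1) t' = 0 := by
    rw [← hii, mapM_comp, ht']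
    exact hconn.mapH_eq_zero
  obtain ⟨ε⟩ := D.nonempty_addEquiv
  -- As `H^{d+1}(G, 𝔽_p)` is one-dimensional, `t` is a multiple of the nonzero `t'`.
  obtain ⟨c, rfl⟩ := ZMod.exists_nsmul_eq ε ht0 t
  rw [map_nsmul, hit, smul_zero]

end ContCoh

/-! ### Right exactness of `H^{d+1}` on finite modules. -/

lemma Submodule.exists_le_ker_addMonoidHom {p : ℕ} [Fact p.Prime] {Y : Type*} [AddCommGroup Y]
    [Module (ZMod p) Y] {I : AddSubgroup Y} {y : Y} (hy : y ∉ I) :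
    ∃ f : Y →+ ZMod p, f y ≠ 0 ∧ ∀ x ∈ I, f x = 0 := by
  obtain ⟨f, hf, hI⟩ := Submodule.exists_le_ker_of_notMem (p := AddSubgroup.toZModSubmodule p I)
    (v := y) hy
  exact ⟨f.toAddMonoidHom, hf, fun x hx => hI hx⟩

/-- Since `U` is normal, `s` is constant on the fibres of `G ⧸ V → G ⧸ U`. Each fibre has
`V.relIndex U` elements, so its contribution is zero. -/
lemma Subgroup.sum_quotient_eq_zero {G Y : Type*} [Group G] [AddCommGroup Y] {U V : Subgroup G}
    [U.Normal] [V.FiniteIndex] (h : V ≤ U) [Fintype (G ⧸ V)] (s : G ⧸ V → Y)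
    (hs : ∀ u ∈ U, ∀ x, s (u • x) = s x) (hY : ∀ y : Y, V.relIndex U • y = 0) :
    ∑ x, s x = 0 := by
  have hU : U.FiniteIndex := Subgroup.finiteIndex_of_le h
  have hVU : (V.subgroupOf U).FiniteIndex := inferInstance
  have : Fintype (G ⧸ U) := Fintype.ofFinite _
  have : Fintype (U ⧸ V.subgroupOf U) := Fintype.ofFinite _
  rw [← (Subgroup.quotientEquivProdOfLE h).symm.sum_comp, Fintype.sum_prod_type]
  refine Finset.sum_eq_zero fun y _ => ?_
  have key : ∀ t : U ⧸ V.subgroupOf U,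
      s ((Subgroup.quotientEquivProdOfLE h).symm (y, t)) = s (QuotientGroup.mk y.out) := by
    intro t
    induction t using QuotientGroup.induction_on with
    | H t =>
      have h1 : (Subgroup.quotientEquivProdOfLE h).symm (y, QuotientGroup.mk t) =
          (y.out * t * y.out⁻¹) • (QuotientGroup.mk y.out : G ⧸ V) := by
        change (QuotientGroup.mk (y.out * t) : G ⧸ V) =
          QuotientGroup.mk (y.out * t * y.out⁻¹ * y.out)
        rw [inv_mul_cancel_right]
      rw [h1, hs _ (‹U.Normal›.conj_mem _ t.2 _)]
  rw [Finset.sum_congr rfl fun t _ => key t, Finset.sum_const, Finset.card_univ,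
    ← Nat.card_eq_fintype_card]
  exact hY _

namespace IsProPGroup

variable {G : Type u} [Group G] [TopologicalSpace G] [IsTopologicalGroup G] {p : ℕ}

lemma finiteIndex (hG : IsProPGroup G p) {U : Subgroup G} (hU : IsOpen (U : Set G)) :
    U.FiniteIndex := by
  have := hG.compactSpace
  have := U.quotient_finite_of_isOpen hU
  exact U.finiteIndex_of_finite_quotient

/-- An open normal subgroup `U` of an infinite pro-`p` group contains an open normal subgroup of
index divisible by `p` in `U`. -/
lemma exists_dvd_relIndex [Fact p.Prime] [Infinite G] (hG : IsProPGroup G p) {U : Subgroup G}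
    [U.Normal] (hU : IsOpen (U : Set G)) :
    ∃ V : Subgroup G, V.Normal ∧ IsOpen (V : Set G) ∧ V ≤ U ∧ p ∣ V.relIndex U := by
  have := hG.compactSpace
  have := hG.totallyDisconnectedSpace
  have hUf := hG.finiteIndex hU
  -- As `G` is infinite, `U` is nontrivial. Intersecting with an open normal subgroup that misses
  -- `u` makes the relative index a nontrivial power of `p`.
  obtain ⟨u, huU, hu⟩ : ∃ u ∈ U, u ≠ 1 := by
    by_contra! h
    have hb : U = ⊥ := (Subgroup.eq_bot_iff_forall U).mpr h
    have := U.finite_quotient_of_finiteIndex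
    have : Finite (G ⧸ (⊥ : Subgroup G)) := hb ▸ this
    exact not_finite_iff_infinite.mpr ‹Infinite G›
      (Finite.of_equiv _ QuotientGroup.quotientBot.toEquiv)
  have hcl : IsClosed ({u} : Set G) := by
    rw [← totallyDisconnectedSpace_iff_connectedComponent_singleton.mp ‹_› u]
    exact isClosed_connectedComponent
  obtain ⟨W, hW⟩ := ProfiniteGrp.exist_openNormalSubgroup_sub_open_nhds_of_one (hcl.isOpen_compl)
    (fun h => hu (Set.mem_singleton_iff.mp h).symm)
  have hWU : IsOpen ((W.toSubgroup ⊓ U : Subgroup G) : Set G) := W.isOpen'.inter hU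
  refine ⟨W.toSubgroup ⊓ U, inferInstance, hWU, inf_le_right, ?_⟩
  obtain ⟨m, hm⟩ := hG.index_eq_pow _ inferInstance hWU
  have hd : (W.toSubgroup ⊓ U).relIndex U ∣ p ^ m := by
    rw [← hm]
    exact Subgroup.relIndex_dvd_index_of_le inf_le_right
  obtain ⟨j, -, hj⟩ := (Nat.dvd_prime_pow Fact.out).mp hd
  rcases Nat.eq_zero_or_pos j with rfl | hj0
  · rw [pow_zero, Subgroup.relIndex_eq_one] at hj
    exact absurd rfl (hW (hj huU).1)
  · rw [hj]
    exact dvd_pow_self p hj0.ne'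

end IsProPGroup

namespace ContCoh

open TopRep ContRepresentation MonoidAlgebra

variable {p : ℕ} [Fact p.Prime] {G : Type u} [Group G]

section Ind

variable (V : Subgroup G) (M : Type u) [AddCommGroup M] [Module (ZMod p) M]
  [Module (MonoidAlgebra (ZMod p) G) M] [IsScalarTower (ZMod p) (MonoidAlgebra (ZMod p) G) M]

/-- The representation of `G` on the functions `G ⧸ V → M`. -/
noncomputable def funRep : Representation (ZMod p) G (G ⧸ V → M) where
  toFun g :=
    { toFun h x := MonoidAlgebra.of (ZMod p) G g • h (g⁻¹ • x)
      map_add' h h' := funext fun x => smul_add _ _ _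
      map_smul' c h := funext fun x => smul_comm _ _ _ }
  map_one' := LinearMap.ext fun h => funext fun x => by
    change MonoidAlgebra.of (ZMod p) G 1 • h ((1 : G)⁻¹ • x) = h x
    rw [map_one, one_smul, inv_one, one_smul]
  map_mul' g g' := LinearMap.ext fun h => funext fun x => by
    change MonoidAlgebra.of (ZMod p) G (g * g') • h ((g * g')⁻¹ • x) =
      MonoidAlgebra.of (ZMod p) G g • MonoidAlgebra.of (ZMod p) G g' • h (g'⁻¹ • g⁻¹ • x)
    rw [map_mul, mul_smul, mul_inv_rev, mul_smul g'⁻¹]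

/-- The `𝔽_p[G]`-module of functions `G ⧸ V → M`. -/
abbrev FunMod : Type u := (funRep (p := p) V M).asModule

variable {V M}

lemma FunMod.of_smul_apply (g : G) (h : FunMod (p := p) V M) (x : G ⧸ V) :
    (show G ⧸ V → M from MonoidAlgebra.of (ZMod p) G g • h) x =
      MonoidAlgebra.of (ZMod p) G g • (show G ⧸ V → M from h) (g⁻¹ • x) := by
  have h1 := (funRep (p := p) V M).asModuleEquiv_symm_map_rho g h
  exact (congrFun h1 x).symm

variable (V M) in
/-- The embedding of `M` in `FunMod V M` as constant functions. -/
noncomputable def FunMod.const : M →ₗ[MonoidAlgebra (ZMod p) G] FunMod (p := p) V M :=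
  equivariantHom (AddMonoidHom.mk' (fun m => (fun _ => m : G ⧸ V → M)) fun _ _ => rfl) fun g m =>
    funext fun x => (FunMod.of_smul_apply g (fun _ => m : G ⧸ V → M) x).symm

lemma FunMod.const_injective : Function.Injective (FunMod.const (p := p) V M) := fun _ _ h =>
  congrFun h (QuotientGroup.mk 1)

lemma isSmooth_funMod [TopologicalSpace G] [IsTopologicalGroup G] [IsSmooth (ZMod p) G M] [Finite M]
    [V.Normal] (hV : IsOpen (V : Set G)) : IsSmooth (ZMod p) G (FunMod (p := p) V M) where
  isOpen_stab h := by
    refine Subgroup.isOpen_mono (H₁ := V ⊓ (permHom (ZMod p) G M).ker) (fun g hg => ?_)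
      (hV.inter isOpen_ker_permHom)
    rw [mem_stab]
    refine funext fun x => (FunMod.of_smul_apply g h x).trans ?_
    have h1 : g⁻¹ • x = x := by
      induction x using QuotientGroup.induction_on with
      | H x =>
        change (QuotientGroup.mk (g⁻¹ * x) : G ⧸ V) = QuotientGroup.mk x
        rw [QuotientGroup.eq, mul_inv_rev, inv_inv]
        exact ‹V.Normal›.conj_mem' _ hg.1 x
    rw [h1]
    exact DFunLike.congr_fun (MonoidHom.mem_ker.mp hg.2) _

/-- The invariant functionals on `FunMod V M` vanish on the constant functions if the index of `V`
in a normal subgroup acting trivially on `M` is divisible by `p`. -/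
lemma FunMod.map_const_eq_zero [V.FiniteIndex] {U : Subgroup G} [U.Normal] (hVU : V ≤ U)
    (hU : ∀ u ∈ U, ∀ m : M, MonoidAlgebra.of (ZMod p) G u • m = m) (hp : p ∣ V.relIndex U)
    (r : FunMod (p := p) V M →ₗ[MonoidAlgebra (ZMod p) G] Fp.{u} p) (m : M) :
    r (FunMod.const V M m) = 0 := by
  classical
  have : Fintype (G ⧸ V) := Fintype.ofFinite _
  -- A constant function is the sum of point masses. As `U` acts trivially on `m`, it permutes them
  -- by translation, so `r` takes equal values on a `U`-orbit, and `p` divides the orbit size.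
  have h1 : FunMod.const (p := p) V M m =
      ∑ x, (show FunMod (p := p) V M from Pi.single x m) :=
    (Finset.univ_sum_single (fun _ : G ⧸ V => m)).symm
  rw [h1, map_sum]
  refine Subgroup.sum_quotient_eq_zero hVU _ (fun u hu x => ?_) fun y => ?_
  · have h2 : (show FunMod (p := p) V M from Pi.single (u • x) m) =
        MonoidAlgebra.of (ZMod p) G u • (show FunMod (p := p) V M from Pi.single x m) := by
      refine funext fun z => Eq.trans ?_ (FunMod.of_smul_apply u _ z).symm
      change Pi.single (M := fun _ => M) (u • x) m z =
        MonoidAlgebra.of (ZMod p) G u • Pi.single (M := fun _ => M) x m (u⁻¹ • z)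
      rw [hU u hu, Pi.single_apply, Pi.single_apply]
      simp only [inv_smul_eq_iff]
    rw [h2, map_smul, of_smul_Fp]
  · obtain ⟨c, hc⟩ := hp
    rw [hc, mul_comm, mul_smul, p_nsmul_eq_zero (p := p), smul_zero]

end Ind

variable [TopologicalSpace G] [IsTopologicalGroup G]
  {k : Type v} [CommRing k] [TopologicalSpace k] [DiscreteTopology k] [Algebra k (ZMod p)] {d : ℕ}
  {A : Type u} [AddCommGroup A] [Module (ZMod p) A]
  [Module (MonoidAlgebra (ZMod p) G) A] [IsScalarTower (ZMod p) (MonoidAlgebra (ZMod p) G) A]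
  [IsSmooth (ZMod p) G A]
  {B : Type u} [AddCommGroup B] [Module (ZMod p) B]
  [Module (MonoidAlgebra (ZMod p) G) B] [IsScalarTower (ZMod p) (MonoidAlgebra (ZMod p) G) B]
  [IsSmooth (ZMod p) G B] [Finite B]

/-- A surjection `A → 𝔽_p` which does not extend to a module `D ⊇ A` is onto on `H^{d+1}`. -/
lemma HasDuality.exists_mapM_eq_of_embedding (D : HasDuality p G k d) (hG : IsProPGroup G p)
    (f : A →ₗ[MonoidAlgebra (ZMod p) G] Fp.{u} p) (hf : f ≠ 0)
    (ι : A →ₗ[MonoidAlgebra (ZMod p) G] B) (hι : Function.Injective ι)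
    (h : ∀ (r : B →ₗ[MonoidAlgebra (ZMod p) G] Fp.{u} p) a, r (ι a) = 0)
    (t : HM (ZMod p) G (Fp.{u} p) k (d + 1)) : ∃ a, mapM k f (d + 1) a = t := by
  have := hG.compactSpace
  have hfs := Fp.surjective_of_ne_zero hf
  let K := (LinearMap.ker f).map ι
  have hle : LinearMap.ker f ≤ K.comap ι := Submodule.map_le_iff_le_comap.mp le_rfl
  -- The sequence `A → B → B/ι(A)` is pushed out along `f` to `𝔽_p → B/K → B/ι(A)`.
  let i : Fp.{u} p →ₗ[MonoidAlgebra (ZMod p) G] B ⧸ K :=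
    ((LinearMap.ker f).mapQ K ι hle) ∘ₗ
      (f.quotKerEquivOfSurjective hfs).symm.toLinearMap
  have hi : ∀ a, i (f a) = K.mkQ (ι a) := fun a => by
    have h1 : (f.quotKerEquivOfSurjective hfs).symm (f a) = (LinearMap.ker f).mkQ a := by
      rw [LinearEquiv.symm_apply_eq]
      rfl
    change (LinearMap.ker f).mapQ K ι hle ((f.quotKerEquivOfSurjective hfs).symm (f a)) = _
    rw [h1]
    rfl
  have hK : K ≤ LinearMap.range ι := LinearMap.map_le_range
  let q : B ⧸ K →ₗ[MonoidAlgebra (ZMod p) G] B ⧸ LinearMap.range ι := Submodule.factor hK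
  have hinj : Function.Injective i := by
    rw [injective_iff_map_eq_zero]
    intro s hs
    obtain ⟨a, rfl⟩ := hfs s
    rw [hi, Submodule.mkQ_apply, Submodule.Quotient.mk_eq_zero] at hs
    obtain ⟨b, hb, hba⟩ := hs
    rw [← hι hba]
    exact hb
  have hex : Function.Exact i q := by
    intro x
    obtain ⟨b, rfl⟩ := K.mkQ_surjective x
    have hqb : q (K.mkQ b) = (LinearMap.range ι).mkQ b := rfl
    rw [hqb, Submodule.mkQ_apply, Submodule.Quotient.mk_eq_zero]
    constructor
    · rintro ⟨a, rfl⟩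
      exact ⟨f a, hi a⟩
    · rintro ⟨s, hs⟩
      obtain ⟨a, rfl⟩ := hfs s
      rw [hi, Submodule.mkQ_apply, Submodule.mkQ_apply, Submodule.Quotient.eq] at hs
      have := (LinearMap.range ι).sub_mem ⟨a, rfl⟩ (hK hs)
      rwa [sub_sub_cancel] at this
  have S1 : IsSES (repMap k ι) (repMap k (LinearMap.range ι).mkQ) :=
    isSES_repMap k hι (LinearMap.exact_map_mkQ_range ι) (Submodule.mkQ_surjective _)
  have S2 : IsSES (repMap k i) (repMap k q) :=
    isSES_repMap k hinj hex (Submodule.factor_surjective hK)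
  have hfin : Finite (B ⧸ K) := Finite.of_surjective _ K.mkQ_surjective
  -- Every functional on `B/K` kills the image of `𝔽_p`, so separation forces `i` to be zero on
  -- `H^{d+1}`.
  have hit : mapM k i (d + 1) t = 0 := D.eq_zero_of_forall_hom hG _ _ rfl _ fun r => by
    rw [← mapM_comp]
    have h0 : r ∘ₗ i = 0 := LinearMap.ext fun s => by
      obtain ⟨a, rfl⟩ := hfs s
      rw [LinearMap.comp_apply, hi]
      exact h (r ∘ₗ K.mkQ) a
    rw [h0, mapM_zero]
  obtain ⟨c, hc⟩ := S2.exists_conn_of_mapH_eq_zero t hit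
  obtain ⟨a, ha⟩ := S1.exists_conn c
  -- Both sequences end in `B/ι(A)`: `t` and `a` are the images of the same `c`, so naturality gives
  -- `f_* a = t`.
  have hm := ha.map (repMap k f) (repMap k K.mkQ) ContIntertwiningMap.id (i' := repMap k i)
    (q' := repMap k q) (by
      apply ContIntertwiningMap.toFun_injective
      exact funext fun a => (hi a).symm) (by
      apply ContIntertwiningMap.toFun_injective
      rfl)
  rw [mapH_id] at hm
  exact ⟨a, S2.conn_unique hm hc⟩

variable [Finite A]

/-- The embedding is by constant functions on `G ⧸ V`, where `p` divides the index of `V` in the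
kernel of the action on `A`. Such a `V` exists because `G` is infinite. -/
lemma HasDuality.exists_mapM_eq [Infinite G] (D : HasDuality p G k d) (hG : IsProPGroup G p)
    (f : A →ₗ[MonoidAlgebra (ZMod p) G] Fp.{u} p) (hf : f ≠ 0)
    (t : HM (ZMod p) G (Fp.{u} p) k (d + 1)) : ∃ a, mapM k f (d + 1) a = t := by
  obtain ⟨V, hVn, hV, hVU, hp⟩ := hG.exists_dvd_relIndex
    (isOpen_ker_permHom (κ := ZMod p) (G := G) (M := A))
  have hVf := hG.finiteIndex hV
  have := isSmooth_funMod (p := p) (M := A) hV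
  have : Finite (FunMod (p := p) V A) := inferInstanceAs (Finite (G ⧸ V → A))
  exact D.exists_mapM_eq_of_embedding hG f hf (FunMod.const V A) FunMod.const_injective
    (fun r a => FunMod.map_const_eq_zero hVU
      (fun u hu m => DFunLike.congr_fun (MonoidHom.mem_ker.mp hu) m) hp r a) t

/-- `H^{d+1}` is right exact on finite modules. -/
theorem HasDuality.mapM_surjective [Infinite G] (D : HasDuality p G k d) (hG : IsProPGroup G p)
    (π : A →ₗ[MonoidAlgebra (ZMod p) G] B) (hπ : Function.Surjective π) :
    Function.Surjective (mapM k π (d + 1)) := by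
  by_contra! hc
  obtain ⟨c, hc⟩ := not_forall.mp hc
  obtain ⟨ε⟩ := D.nonempty_addEquiv
  have : Finite (B →ₗ[MonoidAlgebra (ZMod p) G] Fp.{u} p) := DFunLike.finite _
  let _ : Module (ZMod p) (HM (ZMod p) G B k (d + 1)) :=
    AddCommGroup.zmodModule (nsmul_eq_zero_of_forall k p_nsmul_eq_zero (d + 1))
  let Φ : (B →ₗ[MonoidAlgebra (ZMod p) G] Fp.{u} p) →+
      (HM (ZMod p) G B k (d + 1) →+ ZMod p) :=
    AddMonoidHom.mk' (fun f => ε.toAddMonoidHom.comp (mapM k f (d + 1)).toAddMonoidHom)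
      fun f g => AddMonoidHom.ext fun y => by
        change ε (mapM k (f + g) (d + 1) y) = ε (mapM k f (d + 1) y) + ε (mapM k g (d + 1) y)
        rw [← mapMHom_apply, map_add, map_add]
        rfl
  have hΦ : ∀ f y, Φ f y = 0 ↔ mapM k f (d + 1) y = 0 := fun f y =>
    map_eq_zero_iff ε ε.injective
  have hfin : Finite (AddMonoidHom.range Φ) := Set.finite_range Φ
  obtain ⟨φ, hφc, hφ⟩ := Submodule.exists_le_ker_addMonoidHom (p := p)
    (I := (mapM k π (d + 1)).toAddMonoidHom.range) hc
  -- The functionals coming from `Hom_G(B, 𝔽_p)` are finite in number and separate points, so they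
  -- exhaust the dual of `H^{d+1}(G, B)`.
  obtain ⟨f, rfl⟩ := AddMonoidHom.mem_of_forall_eq_zero (AddMonoidHom.range Φ) φ fun y hy => by
    rw [D.eq_zero_of_forall_hom hG _ B rfl y fun f => (hΦ f y).mp (hy _ ⟨f, rfl⟩), map_zero]
  have hfπ : f ∘ₗ π ≠ 0 := fun h0 => hφc ((hΦ f c).mpr (by
    have : f = 0 := LinearMap.ext fun b => by
      obtain ⟨a, rfl⟩ := hπ b
      exact LinearMap.congr_fun h0 a
    rw [this, mapM_zero]))
  -- The nonzero map `f ∘ π` is onto on `H^{d+1}`, yet `φ` vanishes on the image of `π`.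
  obtain ⟨a, ha⟩ := D.exists_mapM_eq hG (f ∘ₗ π) hfπ (ε.symm 1)
  have h0 : mapM k f (d + 1) (mapM k π (d + 1) a) = 0 := (hΦ f _).mp (hφ _ ⟨a, rfl⟩)
  rw [mapM_comp, h0] at ha
  have := congrArg ε ha
  rw [map_zero, AddEquiv.apply_symm_apply] at this
  exact zero_ne_one this

end ContCoh

/-! ### Reduction of torsion modules to finite submodules. -/

/-- A stable additive subgroup of a `κ[G]`-module is a submodule if `κ` is a quotient of `ℤ`. -/
def AddSubgroup.toSubmoduleOfStable {κ G M : Type*} [CommRing κ] [Group G] [AddCommGroup M]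
    [Module κ M] [Module (MonoidAlgebra κ G) M] [IsScalarTower κ (MonoidAlgebra κ G) M]
    (hκ : Function.Surjective (Int.cast : ℤ → κ)) (C : AddSubgroup M)
    (hC : ∀ (g : G), ∀ x ∈ C, MonoidAlgebra.of κ G g • x ∈ C) :
    Submodule (MonoidAlgebra κ G) M where
  __ := C
  smul_mem' a x hx := by
    induction a using MonoidAlgebra.induction_on with
    | of g => exact hC g x hx
    | add a b ha hb => rw [add_smul]; exact C.add_mem ha hb
    | smul c a ha =>
      obtain ⟨z, rfl⟩ := hκ c
      rw [smul_assoc, Int.cast_smul_eq_zsmul]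
      exact C.zsmul_mem ha z

namespace ContCoh

open TopRep ContRepresentation MonoidAlgebra

section FiniteSubmodules

variable {κ : Type w} [CommRing κ] {G : Type u} [Group G] [TopologicalSpace G]
  [IsTopologicalGroup G] [CompactSpace G]
  {M : Type u} [AddCommGroup M] [Module (MonoidAlgebra κ G) M] [IsSmooth κ G M]

lemma finite_orbit (m : M) : (Set.range fun g : G => MonoidAlgebra.of κ G g • m).Finite := by
  let _ : TopologicalSpace M := ⊥
  have : DiscreteTopology M := ⟨rfl⟩
  exact (isCompact_range ((continuous_of_smul κ (M := M) (G := G)).comp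
    (continuous_id.prodMk (continuous_const (y := m))))).finite_of_discrete

variable [Module κ M] [IsScalarTower κ (MonoidAlgebra κ G) M]

/-- In a smooth torsion module over a compact group every finite subset is contained in a finite
submodule. -/
lemma exists_finite_submodule (hκ : Function.Surjective (Int.cast : ℤ → κ))
    (hM : IsAddTorsion M) {T : Set M} (hT : T.Finite) :
    ∃ N : Submodule (MonoidAlgebra κ G) M, Finite N ∧ T ⊆ N := by
  let O : Set M := ⋃ m ∈ T, Set.range fun g : G => MonoidAlgebra.of κ G g • m
  have hO : O.Finite := hT.biUnion fun m _ => finite_orbit m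
  let C : AddSubgroup M := AddSubgroup.closure O
  have hof : ∀ (g : G), ∀ x ∈ C, MonoidAlgebra.of κ G g • x ∈ C := fun g x hx => by
    induction hx using AddSubgroup.closure_induction with
    | mem x hx =>
      obtain ⟨m, hm, h, rfl⟩ := Set.mem_iUnion₂.mp hx
      refine AddSubgroup.subset_closure (Set.mem_biUnion hm ⟨g * h, ?_⟩)
      change MonoidAlgebra.of κ G (g * h) • m = MonoidAlgebra.of κ G g • MonoidAlgebra.of κ G h • m
      rw [map_mul, mul_smul]
    | zero => rw [smul_zero]; exact C.zero_mem
    | add x y _ _ hx hy => rw [smul_add]; exact C.add_mem hx hy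
    | neg x _ hx => rw [smul_neg]; exact C.neg_mem hx
  have := hO.to_subtype
  have hfg : AddGroup.FG C := AddGroup.closure_finite_fg O
  have hfin : Finite C := AddCommGroup.finite_of_fg_isAddTorsion C fun x => by
    exact (AddSubmonoid.isOfFinAddOrder_coe (H := C.toAddSubmonoid)).mp (hM x.1)
  refine ⟨C.toSubmoduleOfStable hκ hof, hfin, fun m hm => ?_⟩
  refine AddSubgroup.subset_closure (Set.mem_biUnion hm ⟨1, ?_⟩)
  change MonoidAlgebra.of κ G 1 • m = m
  rw [map_one, one_smul]

variable (k : Type v) [CommRing k] [TopologicalSpace k] [DiscreteTopology k] [Algebra k κ]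

/-- A continuous function from the compact `G` to a discrete module has finitely many values. By
induction each of them comes from a finite submodule, and finitely many of these lie in a common
one. -/
lemma exists_resMap_eq (hκ : Function.Surjective (Int.cast : ℤ → κ)) (hM : IsAddTorsion M) (m : ℕ)
    (z : resolutionX.{v, u, u} (toRep κ M k (G := G)) m) :
    ∃ N : Submodule (MonoidAlgebra κ G) M, Finite N ∧
      ∃ y : resolutionX.{v, u, u} (toRep κ N k (G := G)) m,
        resMap (repMap k N.subtype) m y = z := by
  induction m with
  | zero =>
    change M at z
    obtain ⟨N, hN, hz⟩ := exists_finite_submodule (G := G) hκ hM (Set.finite_singleton z)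
    exact ⟨N, hN, (⟨z, hz rfl⟩ : N), rfl⟩
  | succ m ih =>
    change C(G, resolutionX.{v, u, u} (toRep κ M k (G := G)) m) at z
    have := (isDiscreteRep_resolutionX
      (isDiscreteRep_toRep κ k : IsDiscreteRep (toRep κ M k (G := G))) m).discreteTopology
    have hfin : (Set.range z).Finite := (isCompact_range z.continuous).finite_of_discrete
    choose N hN y hy using ih
    obtain ⟨L, hL, hNL⟩ := exists_finite_submodule (G := G) hκ hM
      (hfin.biUnion fun v _ => Set.toFinite (N v : Set M))
    have hle : ∀ x, N (z x) ≤ L := fun x => by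
      refine Set.Subset.trans ?_ hNL
      exact Set.subset_biUnion_of_mem (u := fun v => (N v : Set M)) ⟨x, rfl⟩
    classical
    -- The default `0` is not used: `N v ≤ L` for every value `v` of `z`.
    let s : resolutionX.{v, u, u} (toRep κ M k (G := G)) m →
        resolutionX.{v, u, u} (toRep κ L k (G := G)) m := fun v =>
      if h : N v ≤ L then resMap (repMap k (Submodule.inclusion h)) m (y v) else 0
    refine ⟨L, hL, (⟨fun x => s (z x),
      (continuous_of_discreteTopology (f := s)).comp z.continuous⟩ :
      C(G, resolutionX.{v, u, u} (toRep κ L k (G := G)) m)), ContinuousMap.ext fun x => ?_⟩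
    change resMap (repMap k L.subtype) m (s (z x)) = z x
    simp only [s, dif_pos (hle x)]
    rw [← resMap_comp]
    exact hy (z x)

/-- Every cohomology class of a smooth torsion module comes from a finite submodule. -/
theorem exists_mapM_subtype_eq (hκ : Function.Surjective (Int.cast : ℤ → κ)) (hM : IsAddTorsion M)
    (n : ℕ) (x : HM κ G M k n) :
    ∃ N : Submodule (MonoidAlgebra κ G) M, Finite N ∧
      ∃ y : HM κ G N k n, mapM k N.subtype n y = x := by
  obtain ⟨z, rfl⟩ := cls_surjective _ n x
  obtain ⟨N, hN, y, hy⟩ := exists_resMap_eq k hκ hM (n + 1) z.1.1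
  have hinj := resMap_injective (repMap k N.subtype) (G := G) Subtype.val_injective
  have hinv : y ∈ (resolutionX.{v, u, u} (toRep κ N k (G := G)) (n + 1)).ρ.invariants := fun g =>
    hinj (n + 1) (by
      rw [(resMap (repMap k N.subtype) (n + 1)).isIntertwining, hy]
      exact z.1.2 g)
  let c : Cochain (toRep κ N k (G := G)) n := ⟨y, hinv⟩
  have hc : mapCochain (repMap k N.subtype) n c = z.1 := Subtype.ext hy
  have hcoc : c ∈ Cocycle _ n := by
    refine mapCochain_injective (repMap k N.subtype) (G := G) Subtype.val_injective (n + 1) ?_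
    rw [← dCochain_mapCochain, hc, map_zero]
    exact z.2
  refine ⟨N, hN, cls _ n ⟨c, hcoc⟩, (mapH_cls _ _ _).trans ?_⟩
  exact congrArg _ (Subtype.ext hc)

end FiniteSubmodules

end ContCoh

/-! ### Modules of locally constant functions, and averaging over cosets. -/

namespace ContCoh

open TopRep ContRepresentation MonoidAlgebra

section Coinduced

variable {κ : Type w} [CommRing κ] {G : Type u} [Group G] [TopologicalSpace G]
  [IsTopologicalGroup G]
  {M : Type u} [AddCommGroup M] [Module κ M] [Module (MonoidAlgebra κ G) M]
  [IsScalarTower κ (MonoidAlgebra κ G) M]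

variable (κ G M) in
/-- The representation of `G` on the locally constant functions `G → M`. -/
noncomputable def locConstRep : Representation κ G (LocallyConstant G M) where
  toFun g :=
    { toFun f := (f.comap ⟨fun x => g⁻¹ * x, continuous_const_mul _⟩).map
        fun m => MonoidAlgebra.of κ G g • m
      map_add' f f' := LocallyConstant.ext fun x => smul_add _ _ _
      map_smul' c f := LocallyConstant.ext fun x => smul_comm _ _ _ }
  map_one' := LinearMap.ext fun f => LocallyConstant.ext fun x => by
    change MonoidAlgebra.of κ G 1 • f ((1 : G)⁻¹ * x) = f x
    rw [map_one, one_smul, inv_one, one_mul]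
  map_mul' g g' := LinearMap.ext fun f => LocallyConstant.ext fun x => by
    change MonoidAlgebra.of κ G (g * g') • f ((g * g')⁻¹ * x) =
      MonoidAlgebra.of κ G g • MonoidAlgebra.of κ G g' • f (g'⁻¹ * (g⁻¹ * x))
    rw [map_mul, mul_smul, mul_inv_rev, mul_assoc]

variable (κ G M) in
/-- The coinduced `κ[G]`-module of locally constant functions `G → M`. -/
abbrev LocConstMod : Type u := (locConstRep κ G M).asModule

lemma LocConstMod.of_smul_apply (g : G) (f : LocConstMod κ G M) (x : G) :
    (show LocallyConstant G M from MonoidAlgebra.of κ G g • f) x =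
      MonoidAlgebra.of κ G g • (show LocallyConstant G M from f) (g⁻¹ * x) := by
  have h1 := (locConstRep κ G M).asModuleEquiv_symm_map_rho g f
  exact (LocallyConstant.congr_fun h1 x).symm

variable (κ G M) in
/-- The embedding of `M` in `LocConstMod κ G M` as constant functions. -/
noncomputable def LocConstMod.const : M →ₗ[MonoidAlgebra κ G] LocConstMod κ G M :=
  MonoidAlgebra.equivariantOfLinearOfComm
    { toFun := fun m => LocallyConstant.const G m
      map_add' := fun _ _ => rfl
      map_smul' := fun _ _ => rfl } fun g m =>
    LocallyConstant.ext fun x => (LocConstMod.of_smul_apply g (LocallyConstant.const G m) x).symm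

lemma LocConstMod.const_injective : Function.Injective (LocConstMod.const κ G M) := fun _ _ h =>
  LocallyConstant.congr_fun h 1

variable [CompactSpace G]

lemma LocConstMod.isAddTorsion (hM : IsAddTorsion M) : IsAddTorsion (LocConstMod κ G M) := by
  have h : IsAddTorsion (LocallyConstant G M) := fun f => by
    have hf : (Set.range f).Finite := f.range_finite
    rw [isOfFinAddOrder_iff_nsmul_eq_zero]
    refine ⟨∏ m ∈ hf.toFinset, addOrderOf m, Finset.prod_pos fun m _ => (hM m).addOrderOf_pos,
      LocallyConstant.ext fun x => ?_⟩
    change (∏ m ∈ hf.toFinset, addOrderOf m) • f x = 0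
    rw [← addOrderOf_dvd_iff_nsmul_eq_zero]
    exact Finset.dvd_prod_of_mem _ (hf.mem_toFinset.mpr ⟨x, rfl⟩)
  exact h

variable [IsSmooth κ G M]

variable (k : Type v) [CommRing k] [TopologicalSpace k] [DiscreteTopology k] [Algebra k κ]

variable (κ G M) in
lemma isSmooth_locConstMod : IsSmooth κ G (LocConstMod κ G M) where
  isOpen_stab f := by
    change LocallyConstant G M at f
    let _ : TopologicalSpace κ := ⊥
    have : DiscreteTopology κ := ⟨rfl⟩
    have hd := isDiscreteRep_coind₁ (isDiscreteRep_toRep κ κ : IsDiscreteRep (toRep κ M κ (G := G)))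
    have := hd.discreteTopology
    let _ : TopologicalSpace M := ⊥
    let F : (toRep κ M κ (G := G)).coind₁ := (⟨f, f.isLocallyConstant.continuous⟩ : C(G, M))
    have hc : Continuous fun g : G => (toRep κ M κ (G := G)).coind₁.ρ g F :=
      hd.continuous_action.comp (continuous_id.prodMk continuous_const)
    convert (isOpen_discrete {F}).preimage hc using 1
    ext g
    refine ⟨fun h => ContinuousMap.ext fun x => ?_, fun h => LocallyConstant.ext fun x => ?_⟩
    · exact (LocConstMod.of_smul_apply g f x).symm.trans (LocallyConstant.congr_fun h x)
    · exact (LocConstMod.of_smul_apply g f x).trans (ContinuousMap.congr_fun h x)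

/-- The identification of `C(G, M)` with the locally constant functions. -/
noncomputable def toLocConst :
    (toRep κ M k (G := G)).coind₁.ρ →ⁱL (toRep κ (LocConstMod κ G M) k (G := G)).ρ :=
  letI : TopologicalSpace M := ⊥
  haveI : DiscreteTopology M := ⟨rfl⟩
  letI : TopologicalSpace (LocConstMod κ G M) := ⊥
  letI : Module k M := Module.compHom M (algebraMap k κ)
  haveI : ContinuousSMul k M := ⟨continuous_of_discreteTopology⟩
  letI : Module k (LocConstMod κ G M) := Module.compHom _ (algebraMap k κ)
  { toFun := fun f : C(G, M) =>
      (⟨f, (@IsLocallyConstant.iff_continuous G M _ ⊥ ⟨rfl⟩ f).mpr f.continuous⟩ :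
        LocallyConstant G M)
    map_add' := fun _ _ => rfl
    map_smul' := fun _ _ => rfl
    cont := by
      have := (isDiscreteRep_coind₁
        (isDiscreteRep_toRep κ k : IsDiscreteRep (toRep κ M k (G := G)))).discreteTopology
      exact continuous_of_discreteTopology (α := (toRep κ M k (G := G)).coind₁)
    isIntertwining' := fun g => ContinuousLinearMap.ext fun f => LocallyConstant.ext fun x =>
      (LocConstMod.of_smul_apply (κ := κ) g
        (⟨f, (@IsLocallyConstant.iff_continuous G M _ ⊥ ⟨rfl⟩ f).mpr (f : C(G, M)).continuous⟩ :
          LocallyConstant G M) x).symm }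

/-- The embedding by constant functions factors through `C(G, M)`, where classes of positive degree
die. This is what dimension shifting needs. -/
lemma mapM_const_eq_zero (n : ℕ) (x : HM κ G M k (n + 1)) :
    mapM k (LocConstMod.const κ G M) (n + 1) x = 0 := by
  have h : repMap k (LocConstMod.const κ G M) =
      (toLocConst k).comp (toRep κ M k (G := G)).ρ.coind₁ι :=
    ContIntertwiningMap.toFun_injective rfl
  rw [mapM, h, mapH_comp]
  exact (congrArg _ (mapH_coind₁ι_eq_zero n x)).trans (map_zero _)

end Coinduced

section Averaging

variable {k : Type v} [CommRing k] [TopologicalSpace k] {G : Type u} [Group G] [TopologicalSpace G]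
  [IsTopologicalGroup G] {A : TopRep.{u} k G} {p : ℕ}

/-- The cohomology of a pro-`p` group in positive degrees is `p`-primary torsion. -/
lemma exists_pow_nsmul_eq_zero (hG : IsProPGroup G p) (hA : IsDiscreteRep A) (n : ℕ)
    (x : H A (n + 1)) : ∃ m, p ^ m • x = 0 := by
  have := hG.compactSpace
  have := hG.totallyDisconnectedSpace
  have := (isDiscreteRep_resolutionX hA (n + 1)).discreteTopology
  obtain ⟨z, rfl⟩ := cls_surjective _ _ x
  let f : C(G, resolutionX.{v, u, u} A (n + 1)) := z.1.1
  have hf : ∀ g x, f (g * x) = (resolutionX.{v, u, u} A (n + 1)).ρ g (f x) := fun g x => by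
    have h1 : (resolutionX.{v, u, u} A (n + 1)).ρ g (f (g⁻¹ * (g * x))) = f (g * x) :=
      ContinuousMap.congr_fun (z.1.2 g) (g * x)
    rw [← h1, inv_mul_cancel_left]
  -- Fixing the first variable of a cocycle gives a cochain with coboundary `f`, though not an
  -- invariant one. Summing over coset representatives restores invariance.
  have hd : ∀ x, (TopRep.d.{v, u, u} A (n + 1)).hom (f x) = f := fun x => by
    have h1 := (GPairing.d_succ_apply A (n + 1) f x).symm
    have h2 : (TopRep.d.{v, u, u} A (n + 1 + 1)).hom f = 0 := congrArg Subtype.val z.2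
    rw [h2] at h1
    exact (sub_eq_zero.mp h1).symm
  obtain ⟨V, hV⟩ := ProfiniteGrp.exist_openNormalSubgroup_sub_open_nhds_of_one
    ((isOpen_discrete {f 1}).preimage f.continuous) rfl
  obtain ⟨m, hm⟩ := hG.index_eq_pow V.toSubgroup inferInstance V.isOpen'
  have := hG.finiteIndex (U := V.toSubgroup) V.isOpen'
  have : Fintype (G ⧸ V.toSubgroup) := Fintype.ofFinite _
  -- As `f` is constant on `V` and equivariant, it depends only on the coset `g V`.
  have hout : ∀ g : G, f (QuotientGroup.mk g : G ⧸ V.toSubgroup).out = f g := fun g => by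
    obtain ⟨v, hv⟩ := QuotientGroup.mk_out_eq_mul V.toSubgroup g
    have h1 : f v = f 1 := hV v.2
    rw [hv, hf, h1, ← hf, mul_one]
  let s : resolutionX.{v, u, u} A (n + 1) := ∑ c : G ⧸ V.toSubgroup, f c.out
  have hs : s ∈ (resolutionX.{v, u, u} A (n + 1)).ρ.invariants := fun g => by
    change (resolutionX.{v, u, u} A (n + 1)).ρ g (∑ c : G ⧸ V.toSubgroup, f c.out) = _
    rw [map_sum]
    refine (Finset.sum_congr rfl fun c _ => ?_).trans
      (Equiv.sum_comp (MulAction.toPerm g : Equiv.Perm (G ⧸ V.toSubgroup)) fun c => f c.out)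
    change _ = f (g • c).out
    rw [← hf, ← hout (g * c.out)]
    congr 2
    conv_rhs => rw [← QuotientGroup.out_eq' c]
    rfl
  refine ⟨m, ?_⟩
  rw [← map_nsmul]
  refine (cls_succ_eq_zero_iff _).mpr ⟨⟨s, hs⟩, Subtype.ext ?_⟩
  change (TopRep.d.{v, u, u} A (n + 1)).hom (∑ c : G ⧸ V.toSubgroup, f c.out) = p ^ m • f
  rw [map_sum, Finset.sum_congr rfl fun c _ => hd _, Finset.sum_const, Finset.card_univ, ← hm,
    Subgroup.index_eq_card, Nat.card_eq_fintype_card]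

end Averaging

end ContCoh

/-! ### Vanishing above the dimension. -/

/-- The homomorphism `ZMod n → M`, `1 ↦ m`, for an element `m` with `n • m = 0`. -/
def ZMod.homOfNSMulEqZero {n : ℕ} {M : Type*} [AddCommGroup M] (m : M) (h : n • m = 0) :
    ZMod n →+ M :=
  ZMod.lift n ⟨zmultiplesHom M m, by simpa using h⟩

lemma ZMod.homOfNSMulEqZero_intCast {n : ℕ} {M : Type*} [AddCommGroup M] (m : M) (h : n • m = 0)
    (z : ℤ) : ZMod.homOfNSMulEqZero m h z = z • m :=
  ZMod.lift_coe ..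

namespace ContCoh

open TopRep ContRepresentation MonoidAlgebra

variable {k : Type v} [CommRing k] [TopologicalSpace k] [DiscreteTopology k]
  {G : Type u} [Group G] [TopologicalSpace G] [IsTopologicalGroup G] {p : ℕ} [Fact p.Prime]
  [Algebra k (ZMod p)]

section Vanishing

variable {M : Type u} [AddCommGroup M] [Module k M] [Module (MonoidAlgebra k G) M]
  [IsScalarTower k (MonoidAlgebra k G) M]

/-- The map `𝔽_p → M`, `1 ↦ m`, for an invariant element `m` with `p • m = 0`. -/
noncomputable def repOfFixed (hk : Function.Surjective (Int.cast : ℤ → k)) (m : M) (hp : p • m = 0)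
    (hm : ∀ g : G, MonoidAlgebra.of k G g • m = m) :
    (toRep (ZMod p) (Fp.{u} p) k (G := G)).ρ →ⁱL (toRep k M k (G := G)).ρ :=
  letI : TopologicalSpace (Fp.{u} p) := ⊥
  haveI : DiscreteTopology (Fp.{u} p) := ⟨rfl⟩
  letI : TopologicalSpace M := ⊥
  letI : Module k (Fp.{u} p) := Module.compHom _ (algebraMap k (ZMod p))
  let F : ZMod p →+ M := ZMod.homOfNSMulEqZero m hp
  { toFun := fun t : Fp p => F t.down
    map_add' := fun s t => map_add F s.down t.down
    map_smul' := fun c t => by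
      obtain ⟨z, rfl⟩ := hk c
      change F (algebraMap k (ZMod p) z * t.down) = algebraMap k k z • F t.down
      rw [map_intCast, ← zsmul_eq_mul, map_zsmul, map_intCast, Int.cast_smul_eq_zsmul]
    cont := continuous_bot
    isIntertwining' := fun g => ContinuousLinearMap.ext fun t => by
      let s : Fp.{u} p := t
      change F (MonoidAlgebra.of (ZMod p) G g • s).down = MonoidAlgebra.of k G g • F s.down
      obtain ⟨z, hz⟩ := ZMod.intCast_surjective (n := p) s.down
      rw [of_smul_Fp, ← hz, ZMod.homOfNSMulEqZero_intCast, smul_comm, hm] }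

omit [TopologicalSpace G] [IsTopologicalGroup G] in
lemma repOfFixed_apply (hk : Function.Surjective (Int.cast : ℤ → k)) (m : M) (hp : p • m = 0)
    (hm : ∀ g : G, MonoidAlgebra.of k G g • m = m) (t : Fp.{u} p) (z : ℤ) (hz : t.down = z) :
    repOfFixed hk m hp hm t = z • m := by
  change ZMod.homOfNSMulEqZero m hp t.down = z • m
  rw [hz, ZMod.homOfNSMulEqZero_intCast]

/-- If `H^{n+1}(G, 𝔽_p)` vanishes, so does `H^{n+1}(G, M)` for all finite smooth `M`. -/
lemma eq_zero_of_finite (hG : IsProPGroup G p) (hk : Function.Surjective (Int.cast : ℤ → k))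
    {n : ℕ} (hFp : ∀ x : HM (ZMod p) G (Fp.{u} p) k (n + 1), x = 0) (c : ℕ) (M : Type u)
    [AddCommGroup M] [Module k M] [Module (MonoidAlgebra k G) M]
    [IsScalarTower k (MonoidAlgebra k G) M] [IsSmooth k G M] [Finite M] (hc : Nat.card M = c)
    (x : HM k G M k (n + 1)) : x = 0 := by
  induction c using Nat.strong_induction_on generalizing M with
  | _ c ih =>
  have := hG.compactSpace
  by_cases hpc : p ∣ Nat.card M
  · obtain ⟨m, hm, hf⟩ := exists_fixed_addOrderOf_eq (κ := k) hG hpc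
    have hp : p • m = 0 := hm ▸ addOrderOf_nsmul_eq_zero m
    let S : Submodule (MonoidAlgebra k G) M :=
      (AddSubgroup.zmultiples m).toSubmoduleOfStable hk fun g y hy => by
        obtain ⟨z, rfl⟩ := AddSubgroup.mem_zmultiples_iff.mp hy
        rw [smul_comm, hf]
        exact hy
    have hmS : m ∈ S := AddSubgroup.mem_zmultiples m
    have hS : S ≠ ⊥ := fun h => by
      rw [h, Submodule.mem_bot] at hmS
      rw [hmS, addOrderOf_zero] at hm
      exact (Fact.out : p.Prime).one_lt.ne hm
    have hinj : Function.Injective (repOfFixed hk m hp hf) := by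
      refine (injective_iff_map_eq_zero _).mpr fun t ht => ?_
      change Fp p at t
      obtain ⟨z, hz⟩ := ZMod.intCast_surjective (n := p) t.down
      rw [repOfFixed_apply hk m hp hf t z hz.symm] at ht
      refine ULift.ext _ _ (hz.symm.trans ?_)
      refine (ZMod.intCast_zmod_eq_zero_iff_dvd z p).mpr ?_
      rw [← hm]
      exact addOrderOf_dvd_iff_zsmul_eq_zero.mpr ht
    have hex : Function.Exact (repOfFixed hk m hp hf) (repMap k S.mkQ) := fun y => by
      refine (Submodule.Quotient.mk_eq_zero S).trans
        (AddSubgroup.mem_zmultiples_iff.trans ⟨?_, ?_⟩)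
      · rintro ⟨z, rfl⟩
        exact ⟨(ULift.up (z : ZMod p) : Fp p), repOfFixed_apply hk m hp hf _ z rfl⟩
      · rintro ⟨t, rfl⟩
        change Fp p at t
        obtain ⟨z, hz⟩ := ZMod.intCast_surjective (n := p) t.down
        exact ⟨z, (repOfFixed_apply hk m hp hf t z hz.symm).symm⟩
    have hses : IsSES (repOfFixed hk m hp hf) (repMap k S.mkQ) :=
      ⟨isDiscreteRep_toRep _ k, isDiscreteRep_toRep _ k, isDiscreteRep_toRep _ k, hinj, hex,
        S.mkQ_surjective⟩
    have hfin : Finite (M ⧸ S) := Finite.of_surjective _ S.mkQ_surjective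
    obtain ⟨t, rfl⟩ := hses.exact_mid x
      (ih _ (hc ▸ Submodule.natCard_quotient_lt hS) (M ⧸ S) rfl (mapM k S.mkQ (n + 1) x))
    rw [hFp t, map_zero]
  -- If `p` does not divide the order of `M`, the class is killed both by a power of `p` and by that
  -- order, which are coprime.
  · obtain ⟨r, hr⟩ := exists_pow_nsmul_eq_zero hG (isDiscreteRep_toRep k k) n x
    have h1 := nsmul_eq_zero_of_forall k (fun a : M => card_nsmul_eq_zero') (n + 1) x
    have hco : (p ^ r).Coprime (Nat.card M) :=
      ((Nat.Prime.coprime_iff_not_dvd Fact.out).mpr hpc).pow_left r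
    rw [← AddMonoid.addOrderOf_eq_one_iff]
    exact Nat.eq_one_of_dvd_coprimes hco (addOrderOf_dvd_of_nsmul_eq_zero hr)
      (addOrderOf_dvd_of_nsmul_eq_zero h1)

/-- If `H^{n+1}(G, 𝔽_p)` vanishes, so does `H^{i+1}(G, M)` for all `i ≥ n` and all smooth torsion
modules `M`. -/
lemma eq_zero_of_isAddTorsion (hG : IsProPGroup G p) (hk : Function.Surjective (Int.cast : ℤ → k))
    {n : ℕ} (hFp : ∀ x : HM (ZMod p) G (Fp.{u} p) k (n + 1), x = 0) {i : ℕ} (hi : n ≤ i)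
    (M : Type u) [AddCommGroup M] [Module k M] [Module (MonoidAlgebra k G) M]
    [IsScalarTower k (MonoidAlgebra k G) M] [IsSmooth k G M] (hM : IsAddTorsion M)
    (x : HM k G M k (i + 1)) : x = 0 := by
  have := hG.compactSpace
  induction i, hi using Nat.le_induction generalizing M with
  | base =>
    obtain ⟨N, hN, y, rfl⟩ := exists_mapM_subtype_eq k hk hM _ x
    rw [eq_zero_of_finite hG hk hFp _ N rfl y, map_zero]
  | succ i _ ih =>
    have := isSmooth_locConstMod k G M
    let R := LinearMap.range (LocConstMod.const k G M)
    have hses : IsSES (repMap k (LocConstMod.const k G M)) (repMap k R.mkQ) :=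
      isSES_repMap k LocConstMod.const_injective (LinearMap.exact_map_mkQ_range _)
        R.mkQ_surjective
    -- Dimension shifting: `x` comes from one degree lower in a quotient that is again smooth and
    -- torsion.
    obtain ⟨c, hc⟩ := hses.exists_conn_of_mapH_eq_zero x (mapM_const_eq_zero k _ x)
    have hR : IsAddTorsion (LocConstMod k G M ⧸ R) := fun y => by
      obtain ⟨f, rfl⟩ := R.mkQ_surjective y
      exact R.mkQ.toAddMonoidHom.isOfFinAddOrder (LocConstMod.isAddTorsion hM f)
    rw [ih (LocConstMod k G M ⧸ R) hR c] at hc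
    exact hses.eq_zero_of_conn_zero x hc

end Vanishing

/-- A class is the image under the connecting map of some `c` in `H^{d+1}(L/𝔽_p)`, with `L` the
locally constant functions. As `c` comes from a finite `N`, `HasDuality.mapM_surjective` lifts it to
the preimage of `N` in `L`, and the connecting map kills what lifts to `L`. -/
lemma HasDuality.eq_zero_Fp [Infinite G] {d : ℕ} (D : HasDuality p G k d) (hG : IsProPGroup G p)
    (x : HM (ZMod p) G (Fp.{u} p) k (d + 1 + 1)) : x = 0 := by
  have := hG.compactSpace
  have := isSmooth_locConstMod (ZMod p) G (Fp.{u} p)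
  let j := LocConstMod.const (ZMod p) G (Fp.{u} p)
  let R := LinearMap.range j
  have hses : IsSES (repMap k j) (repMap k R.mkQ) :=
    isSES_repMap k LocConstMod.const_injective (LinearMap.exact_map_mkQ_range _) R.mkQ_surjective
  obtain ⟨c, hc⟩ := hses.exists_conn_of_mapH_eq_zero x (mapM_const_eq_zero k _ x)
  have hR : IsAddTorsion (LocConstMod (ZMod p) G (Fp.{u} p) ⧸ R) := fun y =>
    isOfFinAddOrder_iff_nsmul_eq_zero.mpr ⟨p, (Fact.out : p.Prime).pos, p_nsmul_eq_zero y⟩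
  obtain ⟨N, hN, y, rfl⟩ := exists_mapM_subtype_eq k ZMod.intCast_surjective hR _ c
  let E := N.comap R.mkQ
  let π : E →ₗ[MonoidAlgebra (ZMod p) G] N := R.mkQ.restrict fun _ h => h
  have hπ : Function.Surjective π := fun y => by
    obtain ⟨f, hf⟩ := R.mkQ_surjective y.1
    exact ⟨⟨f, by rw [Submodule.mem_comap, hf]; exact y.2⟩, Subtype.ext hf⟩
  -- The fibres of `E → N` are cosets of `R`, the finite image of `𝔽_p`.
  have hE : Finite E := by
    have h1 : (R : Set (LocConstMod (ZMod p) G (Fp.{u} p))).Finite := Set.finite_range j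
    have h2 : (N : Set (LocConstMod (ZMod p) G (Fp.{u} p) ⧸ R)).Finite := Set.toFinite _
    refine (Set.Finite.preimage' (f := R.mkQ) h2 fun b _ => ?_).to_subtype
    obtain ⟨f, rfl⟩ := R.mkQ_surjective b
    refine (h1.image fun r => f + r).subset fun g hg => ⟨g - f, ?_, add_sub_cancel _ _⟩
    exact (Submodule.Quotient.eq R).mp hg
  obtain ⟨b, rfl⟩ := D.mapM_surjective (A := E) (B := N) hG π hπ y
  have hcomp : N.subtype ∘ₗ π = R.mkQ ∘ₗ E.subtype := rfl
  rw [← mapM_comp, hcomp, mapM_comp] at hc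
  exact hses.conn_unique hc (conn_mapH _)

end ContCoh

/-! ### Transfer to arbitrary discrete modules and to any model of `𝔽_p`. -/

namespace ContCoh

open TopRep ContRepresentation MonoidAlgebra

variable {k : Type v} [CommRing k] [TopologicalSpace k]
  {G : Type u} [Group G]

/-- A continuous additive equivariant map is `k`-linear if `k` is a quotient of `ℤ`. -/
def intertwiningOfInt (hk : Function.Surjective (Int.cast : ℤ → k)) {A B : TopRep.{u} k G}
    (f : A →+ B) (hf : Continuous f) (h : ∀ g a, f (A.ρ g a) = B.ρ g (f a)) : A.ρ →ⁱL B.ρ where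
  toFun := f
  map_add' := f.map_add
  map_smul' c a := by
    obtain ⟨z, rfl⟩ := hk c
    rw [Int.cast_smul_eq_zsmul, map_zsmul, RingHom.id_apply, Int.cast_smul_eq_zsmul]
  cont := hf
  isIntertwining' g := ContinuousLinearMap.ext fun a => h g a

variable [DiscreteTopology k] [TopologicalSpace G] [IsTopologicalGroup G]
  {p : ℕ} [Fact p.Prime] [Algebra k (ZMod p)]

/-- If `H^{n+1}(G, 𝔽_p)` vanishes, so does `H^{i+1}(G, A)` for all `i ≥ n` and all discrete torsion
modules `A`. -/
lemma IsDiscreteRep.eq_zero_of_isAddTorsion (hG : IsProPGroup G p)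
    (hk : Function.Surjective (Int.cast : ℤ → k)) {n : ℕ}
    (hFp : ∀ x : HM (ZMod p) G (Fp.{u} p) k (n + 1), x = 0) {i : ℕ} (hi : n ≤ i)
    {A : TopRep.{u} k G} (hA : IsDiscreteRep A) (ht : IsAddTorsion A) (x : H A (i + 1)) :
    x = 0 := by
  have := hA.discreteTopology
  let ρ : Representation k G A := A.ρ.toRepresentation
  have hρ : ∀ (g : G) (a : A), (show A from MonoidAlgebra.of k G g • (show ρ.asModule from a)) =
      A.ρ g a := fun g a => (ρ.asModuleEquiv_symm_map_rho g a).symm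
  have hsm : IsSmooth k G ρ.asModule := ⟨fun a => by
    have hc : Continuous fun g : G => A.ρ g a :=
      hA.continuous_action.comp (continuous_id.prodMk continuous_const)
    convert (isOpen_discrete {(show A from a)}).preimage hc using 1
    ext g
    exact ⟨fun h => (hρ g a).symm.trans h, fun h => (hρ g a).trans h⟩⟩
  have hB := (isDiscreteRep_toRep k k : IsDiscreteRep (toRep k ρ.asModule k (G := G)))
  have := hB.discreteTopology
  -- Here `a` and `b` are the identity on elements; only the packaging of the module structure and
  -- of the topology differs.
  let a : A.ρ →ⁱL (toRep k ρ.asModule k (G := G)).ρ :=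
    intertwiningOfInt hk (AddMonoidHom.mk' (fun x : A => (show ρ.asModule from x)) fun _ _ => rfl)
      continuous_of_discreteTopology fun g x => (hρ g x).symm
  let b : (toRep k ρ.asModule k (G := G)).ρ →ⁱL A.ρ :=
    intertwiningOfInt hk (AddMonoidHom.mk' (fun x : ρ.asModule => (show A from x)) fun _ _ => rfl)
      continuous_of_discreteTopology fun g x => hρ g x
  have hba : b.comp a = ContIntertwiningMap.id := ContIntertwiningMap.toFun_injective rfl
  rw [← mapH_id (i + 1) x, ← hba, mapH_comp,
    ContCoh.eq_zero_of_isAddTorsion hG hk hFp hi ρ.asModule ht (mapH a (i + 1) x), map_zero]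

/-- The cup product pairing of any model of the trivial module `𝔽_p` gives `HasDuality`. -/
lemma hasDuality_of_pairing (hk : Function.Surjective (Int.cast : ℤ → k)) {T : TopRep.{u} k G}
    [DiscreteTopology T] (e : T ≃+ ZMod p) (hT : ∀ g t, T.ρ g t = t) (μ : GPairing T T T)
    (hμ : ∀ s t, e (μ.toLin s t) = e s * e t) {d : ℕ}
    (hd : Nonempty (H T (d + 1) ≃+ ZMod p))
    (h : ∀ x : H T 1, (∀ y, cup μ 1 d (d + 1) (by omega) x y = 0) → x = 0) :
    HasDuality p G k d := by
  have hB := (isDiscreteRep_toRep (ZMod p) k : IsDiscreteRep (toRep (ZMod p) (Fp.{u} p) k (G := G)))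
  have := hB.discreteTopology
  have hof : ∀ g (t : Fp.{u} p), (toRep (ZMod p) (Fp.{u} p) k (G := G)).ρ g t = t :=
    of_smul_Fp p
  let a : T.ρ →ⁱL (toRep (ZMod p) (Fp.{u} p) k (G := G)).ρ :=
    intertwiningOfInt hk (AddMonoidHom.mk' (fun t : T => (ULift.up (e t) : Fp.{u} p))
      fun s t => congrArg ULift.up (map_add e s t))
      continuous_of_discreteTopology fun g t => (congrArg _ (hT g t)).trans (hof g _).symm
  let b : (toRep (ZMod p) (Fp.{u} p) k (G := G)).ρ →ⁱL T.ρ :=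
    intertwiningOfInt hk (AddMonoidHom.mk' (fun t : Fp.{u} p => e.symm t.down)
      fun s t => map_add e.symm s.down t.down)
      continuous_of_discreteTopology fun g t => (congrArg _ (hof g t)).trans (hT g _).symm
  have hba : b.comp a = ContIntertwiningMap.id :=
    ContIntertwiningMap.toFun_injective (funext fun t => e.symm_apply_apply t)
  have hab : a.comp b = ContIntertwiningMap.id :=
    ContIntertwiningMap.toFun_injective (funext fun t =>
      congrArg ULift.up (e.apply_symm_apply (ULift.down (α := ZMod p) t)))
  have hba' : ∀ n x, mapH b n (mapH a n x) = x := fun n x => by rw [← mapH_comp, hba, mapH_id]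
  have hab' : ∀ n x, mapH a n (mapH b n x) = x := fun n x => by rw [← mapH_comp, hab, mapH_id]
  refine ⟨?_, fun x hx => ?_⟩
  · obtain ⟨ε⟩ := hd
    exact ⟨(AddEquiv.mk ⟨mapH b (d + 1), mapH a (d + 1), hab' _, hba' _⟩ (map_add _)).trans ε⟩
  · rw [← hab' 1 x, h (mapH b 1 x) fun y => ?_, map_zero]
    -- Every class over `T` has the form `mapH b`, so orthogonality is transported along `b`. The
    -- two pairings multiply in opposite orders, hence the `mul_comm`.
    have h1 := cup_mapH (smulPairing k (Fp.{u} p)) μ b b b (fun s t => ?_) 1 d (d + 1) (by omega) x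
      (mapH a d y)
    · rw [hba'] at h1
      rw [h1]
      exact (congrArg _ (hx (mapH a d y))).trans (map_zero _)
    · apply e.injective
      rw [hμ]
      change Fp p at s t
      change e (e.symm s.down) * e (e.symm t.down) = e (e.symm (t.down * s.down : ZMod p))
      rw [e.apply_symm_apply, e.apply_symm_apply, e.apply_symm_apply, mul_comm]

end ContCoh

/-! ### The main theorem. -/

section Main

variable {G : Type u} [Group G] {p : ℕ}

open ContCoh

variable (G p) in
lemma isAddTorsion_trivialFp [Fact p.Prime] : IsAddTorsion (trivialFp G p) := fun t =>
  isOfFinAddOrder_iff_nsmul_eq_zero.mpr ⟨p, (Fact.out : p.Prime).pos, by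
    refine ULift.ext _ _ ?_
    change p • (ULift.down t : ZMod p) = 0
    rw [nsmul_eq_mul, CharP.cast_eq_zero, zero_mul]⟩

variable [TopologicalSpace G]

lemma IsDiscreteGModule.isDiscreteRep {A : TopRep.{u} ℤ G} (hA : IsDiscreteGModule A) :
    IsDiscreteRep A :=
  ⟨hA.discreteTopology, hA.continuous_action⟩

variable (G p) in
lemma isDiscreteGModule_trivialFp : IsDiscreteGModule (trivialFp G p) where
  discreteTopology := inferInstanceAs (DiscreteTopology (ULift.{u} (ZMod p)))
  continuous_action := continuous_snd

variable [IsTopologicalGroup G]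

lemma IsGPDGroup.hasDuality [Fact p.Prime] {d : ℕ} (hG : IsGPDGroup G p (d + 1)) :
    HasDuality p G ℤ d := by
  have : DiscreteTopology (trivialFp G p) := (isDiscreteGModule_trivialFp G p).discreteTopology
  exact hasDuality_of_pairing Function.surjective_id (T := trivialFp G p)
    (AddEquiv.ulift (α := ZMod p)) (fun _ _ => rfl) (mulPairing G p) (fun _ _ => rfl)
    hG.nonempty_addEquiv (hG.nondegenerate 1 d (by omega)).1

end Main

theorem mainTheorem3 (p : ℕ) [Fact p.Prime] (n : ℕ) (hn : 1 ≤ n)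
    (G : Type u) [Group G] [TopologicalSpace G] [IsTopologicalGroup G]
    (hG : IsGPDGroup G p n) :
    cohomologicalDimension G = n := by
  obtain ⟨d, rfl⟩ := Nat.exists_eq_add_of_le' hn
  have := hG.infinite
  have hpro := hG.isProPGroup
  refine le_antisymm (sInf_le fun i hi A hA ht => subsingleton_of_forall_eq 0 fun x => ?_)
    (le_sInf fun m hm => ?_)
  -- A degree above `d + 1` is `i + 1` with `i ≥ d + 1`, so the vanishing of `H^{d+2}(G, 𝔽_p)` is
  -- what is needed.
  · obtain ⟨i, rfl⟩ := Nat.exists_eq_add_of_le' (Nat.one_le_of_lt (Nat.cast_lt.mp hi))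
    exact hA.isDiscreteRep.eq_zero_of_isAddTorsion hpro Function.surjective_id
      (hG.hasDuality.eq_zero_Fp hpro) (Nat.lt_succ_iff.mp (Nat.cast_lt.mp hi)) ht x
  -- A smaller bound would force `H^{d+1}(G, 𝔽_p) ≅ 𝔽_p` to vanish.
  · by_contra! hlt
    have := hm _ hlt _ (isDiscreteGModule_trivialFp G p) (isAddTorsion_trivialFp G p)
    obtain ⟨ε⟩ := hG.nonempty_addEquiv
    exact not_subsingleton (ZMod p) ε.symm.injective.subsingleton
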